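/- **Conventions.** A (right) Leibniz algebra over a commutative ring satisfies $[x,[y,z]]=[[x,y],z]-[[x,z],y]$. Let $\lambda_6=L$ be the complex vector space with basis $e_1,e_2,e_3$ and bracket $[e_1,e_3]=e_2$, $[e_3,e_3]=e_1$, all other brackets of basis vectors being $0$. Write $CL^n=\mathrm{Hom}(L^{\otimes n},L)$, with the Leibniz coboundary $\delta$: $$\delta g(x,y)=[x,g(y)]+[g(x),y]-g([x,y])\quad(g\in CL^1),$$ $$\delta f(x,y,z)=[x,f(y,z)]+[f(x,z),y]-[f(x,y),z]-f([x,y],z)+f([x,z],y)+f(x,[y,z])\quad(f\in CL^2),$$ and $HL^n=HL^n(L;L)$ for its cohomology. For $\alpha,\beta\in CL^2$ put $(\alpha\circ\beta)(x,y,z)=\alpha(\beta(x,y),z)-\alpha(\beta(x,z),y)-\alpha(x,\beta(y,z))$ and $[\alpha,\beta]=\alpha\circ\beta+\beta\circ\alpha\in CL^3$; put $d=-\delta$ on $CL^2$. For $n\ge 2$ and $2$-cocycles $x_1,\dots,x_n$, a *defining system* is a family $(x_I)$ in $CL^2$, indexed by the nonempty proper subsets $I\subset\{1,\dots,n\}$,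 with $x_{\{i\}}=x_i$ and $d x_I=\sum_{\{J,K\}}[x_J,x_K]$ when $|I|\ge2$, the sum being over the unordered partitions $I=J\sqcup K$ into two nonempty subsets. The $n$-fold Massey bracket $\langle [x_1],\dots,[x_n]\rangle$ is then represented by the $3$-cochain $\sum_{\{J,K\},\,J\sqcup K=\{1,\dots,n\}}[x_J,x_K]$. A *base* is a commutative local $\mathbb C$-algebra $A$ with an augmentation $\varepsilon:A\to\mathbb C$, whose maximal ideal $\mathfrak M=\ker\varepsilon$ satisfies $\dim\mathfrak M^k/\mathfrak M^{k+1}<\infty$ for all $k$. A *deformation* of $L$ with base $A$ is an $A$-Leibniz algebra structure on $A\otimes L$ such that $\varepsilon\otimes\mathrm{id}:A\otimes L\to L$ is a homomorphism. Two deformations with base $A$ are *equivalent* if there is an isomorphism of $A$-Leibniz algebras between them compatible with $\varepsilon\otimes\mathrm{id}$. The *push-out* $f_*\eta$ along an augmented algebra homomorphism $f:C\to A$ is the $A$-bilinear bracket with $[1\otimes l,1\otimes l']_{f_*\eta}=(f\otimes \mathrm{id})[1\otimes l,1\otimes l']_\eta$. A deformation $\eta$ with complete base $C$ is *versal* if for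 every deformation $\lambda$ with complete base $A$ there is an augmented homomorphism $f:C\to A$ with $\lambda$ equivalent to $f_*\eta$, and $f$ is unique whenever $\mathfrak M_A^2=0$. An infinitesimal deformation ($\mathfrak M^2=0$) with finite-dimensional base is *universal* if every infinitesimal deformation with finite-dimensional base is equivalent to its push-out along a unique augmented homomorphism. **Theorem.** $\lambda_6$ is a Leibniz algebra. Let $\mu_1,\mu_2\in CL^2$ be given by $\mu_1(e_2,e_3)=-e_1$ and $\mu_2(e_1,e_3)=e_1$, both being zero on all other pairs of basis vectors. 1. *(Massey brackets)* $[\mu_1,\mu_1]=[\mu_1,\mu_2]=[\mu_2,\mu_2]=0$ in $CL^3$. For all $n\ge2$ and $x_1,\dots,x_n$ in the span of $\mu_1,\mu_2$, putting $x_I=0$ for all $I$ with $|I|\ge2$ gives a defining system, and the Massey bracket of $x_1,\dots,x_n$ is thereby represented by the zero cochain. Moreover, for all $n\ge 2$ and all $2$-cocycles $x_1,\dots,x_n$, every cochain representing the Massey bracket $\langle[x_1],\dots,[x_n]\rangle$ is a coboundary, so that it is zero in $HL^3$. 2. *(Universal infinitesimal deformation)* $\mu_1,\mu_2$ are cocycles,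 and $[\mu_1],[\mu_2]$ form a basis of $\mathbb H=HL^2$. Let $t,s$ be the dual basis of $\mathbb H'$, and let $C_1=\mathbb C\oplus\mathbb H'$, with $\mathbb H'\cdot\mathbb H'=0$. Then $$[1\otimes l,1\otimes l']_{\eta_1}=1\otimes[l,l']+t\otimes\mu_1(l,l')+s\otimes\mu_2(l,l')$$ is a universal infinitesimal deformation $\eta_1$ of $\lambda_6$, with base $C_1$. 3. *(Versal deformation)* Let $\eta$ be the bracket on $\mathbb C[[t,s]]\otimes L$ given by the same formula as $\eta_1$, that is, $$[e_1,e_3]=e_2+s\,e_1,\qquad [e_3,e_3]=e_1,\qquad [e_2,e_3]=-t\,e_1,$$ with all other brackets of basis vectors zero. Then $\eta$ is a versal deformation of $\lambda_6$ with base $\mathbb C[[t,s]]$, and $\eta_1$ is its push-out along the surjective homomorphism $\mathbb C[[t,s]]\to C_1$, $t\mapsto t$, $s\mapsto s$, with kernel $(t,s)^2$. There are no obstructions: for every $k\ge0$, every finite-dimensional local base $B$ and every surjective homomorphism $p:B\to C_k=\mathbb C[[t,s]]/(t,s)^{k+1}$, there is a deformation with base $B$ whose push-out along $p$ is the reduction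 of $\eta$ to $C_k$. 4. *(One-parameter deformations)* The push-outs of $\eta$ to $\mathbb C[[t]]$ (setting $s=0$) and to $\mathbb C[[s]]$ (setting $t=0$) are deformations of $\lambda_6$. They are not equivalent when $\mathbb C[[t]]$ and $\mathbb C[[s]]$ are identified by $t=s$, nor by any other isomorphism of $\mathbb C$-algebras. -/

import Mathlib

open scoped TensorProduct

universe u

namespace LeibnizDef

noncomputable section

/-! ## Leibniz brackets and low degree Leibniz cochains -/

section Cochains

variable {R : Type*} [CommRing R] {M : Type*} [AddCommGroup M] [Module R M]

/-- The (right) Leibniz identity for an `R`-bilinear operation. -/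
def IsLeibniz (b : M →ₗ[R] M →ₗ[R] M) : Prop :=
  ∀ x y z : M, b x (b y z) = b (b x y) z - b (b x z) y

variable (R M) in
/-- Leibniz `2`-cochains with coefficients in `M` itself. -/
abbrev CL2 : Type _ := M →ₗ[R] M →ₗ[R] M

variable (R M) in
/-- Leibniz `3`-cochains with coefficients in `M` itself. -/
abbrev CL3 : Type _ := M →ₗ[R] M →ₗ[R] M →ₗ[R] M

/-- Shortcut instance: the usual additive group structure on bilinear maps. -/
instance CL2.instAddCommGroup : AddCommGroup (M →ₗ[R] M →ₗ[R] M) := LinearMap.addCommGroup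

/-- The trilinear map `(x, y, z) ↦ α (β x y) z`. -/
def compLeft (α β : CL2 R M) : CL3 R M := β.compr₂ α

/-- The trilinear map `(x, y, z) ↦ α x (β y z)`. -/
def compRight (α β : CL2 R M) : CL3 R M where
  toFun x := β.compr₂ (α x)
  map_add' x y := by ext; simp
  map_smul' c x := by ext; simp

/-- Interchange the last two arguments of a trilinear map. -/
def swapLast (f : CL3 R M) : CL3 R M where
  toFun x := (f x).flip
  map_add' x y := by ext; simp
  map_smul' c x := by ext; simp

@[simp] theorem compLeft_apply (α β : CL2 R M) (x y z : M) :
    compLeft α β x y z = α (β x y) z := rfl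

@[simp] theorem compRight_apply (α β : CL2 R M) (x y z : M) :
    compRight α β x y z = α x (β y z) := rfl

@[simp] theorem swapLast_apply (f : CL3 R M) (x y z : M) :
    swapLast f x y z = f x z y := rfl

/-- The composition `α ∘ β` of two `2`-cochains. -/
def circ (α β : CL2 R M) : CL3 R M :=
  compLeft α β - swapLast (compLeft α β) - compRight α β

theorem circ_apply (α β : CL2 R M) (x y z : M) :
    circ α β x y z = α (β x y) z - α (β x z) y - α x (β y z) := rfl

/-- The graded Lie bracket of two `2`-cochains (both of degree one in the
differential graded Lie algebra of Leibniz cochains, so the bracket is symmetric). -/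
def superBracket (α β : CL2 R M) : CL3 R M := circ α β + circ β α

/-- The Leibniz coboundary of a `1`-cochain:
`δ g (x, y) = [x, g y] + [g x, y] - g [x, y]`. -/
def delta1 (b : CL2 R M) : (M →ₗ[R] M) →ₗ[R] CL2 R M where
  toFun g := b.compl₂ g + b ∘ₗ g - b.compr₂ g
  map_add' f g := by ext; simp; abel
  map_smul' c g := by ext; simp [smul_sub]

theorem delta1_apply (b : CL2 R M) (g : M →ₗ[R] M) (x y : M) :
    delta1 b g x y = b x (g y) + b (g x) y - g (b x y) := rfl

/-- The Leibniz coboundary of a `2`-cochain, see `delta2_apply`. -/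
def delta2 (b : CL2 R M) : CL2 R M →ₗ[R] CL3 R M where
  toFun f := compRight b f + swapLast (compLeft b f) - compLeft b f
    - compLeft f b + swapLast (compLeft f b) + compRight f b
  map_add' f g := by ext; simp; abel
  map_smul' c f := by ext; simp [smul_sub]

theorem delta2_apply (b f : CL2 R M) (x y z : M) :
    delta2 b f x y z = b x (f y z) + b (f x z) y - b (f x y) z
      - f (b x y) z + f (b x z) y + f x (b y z) := rfl

/-- Leibniz `2`-cocycles of the algebra with bracket `b`. -/
def ZL2 (b : CL2 R M) : Submodule R (CL2 R M) := LinearMap.ker (delta2 b)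

/-- Leibniz `2`-coboundaries. -/
def BL2 (b : CL2 R M) : Submodule R (CL2 R M) := LinearMap.range (delta1 b)

/-- Leibniz `3`-coboundaries. -/
def BL3 (b : CL2 R M) : Submodule R (CL3 R M) := LinearMap.range (delta2 b)

/-- The second Leibniz cohomology of the algebra with bracket `b`, with coefficients in itself. -/
abbrev HL2 (b : CL2 R M) : Type _ := ↥(ZL2 b) ⧸ (BL2 b).comap (ZL2 b).subtype

/-- The cohomology class of a `2`-cocycle. -/
def HL2.mk {b : CL2 R M} (f : ZL2 b) : HL2 b :=
  ((BL2 b).comap (ZL2 b).subtype).mkQ f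

end Cochains

/-! ## Massey brackets of degree two classes -/

section Massey

variable {𝕜 : Type*} [Field 𝕜] {L : Type*} [AddCommGroup L] [Module 𝕜 L]

/-- The sum of the brackets `[m J, m K]` over all *unordered* partitions of `I` into two nonempty
subsets `J`, `K`; it is written as half of the sum over ordered partitions, in which
each unordered one occurs twice (the bracket is symmetric). -/
def masseySum {n : ℕ} (m : Finset (Fin n) → CL2 𝕜 L) (I : Finset (Fin n)) : CL3 𝕜 L :=
  (2⁻¹ : 𝕜) • ∑ J ∈ I.powerset.filter (fun J => J.Nonempty ∧ J ≠ I),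
    superBracket (m J) (m (I \ J))

/-- A defining system for the `n`-fold Massey bracket of the classes of the cocycles `x i`:
`m {i} = x i`, and `d (m I)` is the sum of the brackets over the unordered partitions of `I`, for
every proper subset `I` with at least two elements. The differential of the differential graded Lie
algebra of Leibniz cochains is `d = (-1)^{|α|} δ`, which is `-δ` on `2`-cochains (degree one). The
value of `m` at the whole index set plays no role. -/
def IsDefiningSystem (b : CL2 𝕜 L) {n : ℕ} (x : Fin n → CL2 𝕜 L)
    (m : Finset (Fin n) → CL2 𝕜 L) : Prop :=
  (∀ i, m {i} = x i) ∧
    ∀ I : Finset (Fin n), 2 ≤ I.card → I ≠ Finset.univ → -(delta2 b (m I)) = masseySum m I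

/-- `c` is a `3`-cochain representing the `n`-fold Massey bracket `⟨[x 0], …, [x (n-1)]⟩`. -/
def RepresentsMassey (b : CL2 𝕜 L) {n : ℕ} (x : Fin n → CL2 𝕜 L) (c : CL3 𝕜 L) : Prop :=
  ∃ m : Finset (Fin n) → CL2 𝕜 L, IsDefiningSystem b x m ∧ c = masseySum m Finset.univ

end Massey

/-! ## Deformations over augmented local algebras -/

section Deformations

variable {𝕜 : Type*} [Field 𝕜]

/-- `A` is a local algebra, augmented by `ε`, whose maximal ideal is then `𝔐 = ker ε`,
and `𝔐 ^ k / 𝔐 ^ (k+1)` is finite dimensional for every `k`. -/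
structure IsLocalBase {A : Type*} [CommRing A] [Algebra 𝕜 A] (ε : A →ₐ[𝕜] 𝕜) : Prop where
  isLocalRing : IsLocalRing A
  finite_pow_quotient : ∀ k : ℕ, Module.Finite 𝕜
    (↥(RingHom.ker ε ^ k) ⧸
      (RingHom.ker ε • (⊤ : Submodule A ↥(RingHom.ker ε ^ k))))

/-- A complete local base: moreover `A` is the projective limit of the `A / 𝔐 ^ n`. -/
structure IsCompleteLocalBase {A : Type*} [CommRing A] [Algebra 𝕜 A] (ε : A →ₐ[𝕜] 𝕜) : Prop
    extends IsLocalBase ε where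
  isAdicComplete : IsAdicComplete (RingHom.ker ε) A

variable {L : Type*} [AddCommGroup L] [Module 𝕜 L]

/-- The map `ε ⊗ id : A ⊗ L → 𝕜 ⊗ L = L`. -/
def augMap {A : Type*} [CommRing A] [Algebra 𝕜 A] (ε : A →ₐ[𝕜] 𝕜) : A ⊗[𝕜] L →ₗ[𝕜] L :=
  (TensorProduct.lid 𝕜 L).toLinearMap ∘ₗ LinearMap.rTensor L ε.toLinearMap

/-- A deformation with base `A` of the algebra `(L, b)`: an `A`-Leibniz
algebra structure on `A ⊗ L` such that `ε ⊗ id` is a homomorphism. (For finite dimensional `L` and a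
complete local base `A`, these are also the formal deformations, since then
`A ⊗ L` is the projective limit of the `A / 𝔐 ^ n ⊗ L`.) -/
structure IsDeformation {A : Type*} [CommRing A] [Algebra 𝕜 A] (ε : A →ₐ[𝕜] 𝕜)
    (b : L →ₗ[𝕜] L →ₗ[𝕜] L)
    (ρ : (A ⊗[𝕜] L) →ₗ[A] (A ⊗[𝕜] L) →ₗ[A] (A ⊗[𝕜] L)) : Prop where
  isLeibniz : IsLeibniz ρ
  augMap_hom : ∀ x y : A ⊗[𝕜] L, augMap ε (ρ x y) = b (augMap ε x) (augMap ε y)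

/-- Equivalence of deformations: an isomorphism of `A`-Leibniz algebras which is compatible
with `ε ⊗ id`. -/
def Equivalent {A : Type*} [CommRing A] [Algebra 𝕜 A] (ε : A →ₐ[𝕜] 𝕜)
    (ρ₁ ρ₂ : (A ⊗[𝕜] L) →ₗ[A] (A ⊗[𝕜] L) →ₗ[A] (A ⊗[𝕜] L)) : Prop :=
  ∃ φ : (A ⊗[𝕜] L) ≃ₗ[A] (A ⊗[𝕜] L),
    (∀ x y, φ (ρ₁ x y) = ρ₂ (φ x) (φ y)) ∧ ∀ x, augMap ε (φ x) = augMap ε x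

/-- The `A`-bilinear extension to `A ⊗ L` of a `𝕜`-bilinear map `L × L → A ⊗ L`. -/
def bilinExtend {A : Type*} [CommRing A] [Algebra 𝕜 A]
    (β : L →ₗ[𝕜] L →ₗ[𝕜] (A ⊗[𝕜] L)) :
    (A ⊗[𝕜] L) →ₗ[A] (A ⊗[𝕜] L) →ₗ[A] (A ⊗[𝕜] L) :=
  LinearMap.liftBaseChange A
    (((LinearMap.liftBaseChangeEquiv (R := 𝕜) (M := L) (N := A ⊗[𝕜] L) A).toLinearMap.restrictScalars
      𝕜) ∘ₗ β)

theorem bilinExtend_tmul {A : Type*} [CommRing A] [Algebra 𝕜 A]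
    (β : L →ₗ[𝕜] L →ₗ[𝕜] (A ⊗[𝕜] L)) (a a' : A) (l l' : L) :
    bilinExtend β (a ⊗ₜ[𝕜] l) (a' ⊗ₜ[𝕜] l') = (a * a') • β l l' := by
  simp [bilinExtend, smul_smul]

/-- The `𝕜`-bilinear map `(l, l') ↦ (f ⊗ id) [1 ⊗ l, 1 ⊗ l']` with values in `B ⊗ L`. -/
def pushoutAux {A B : Type*} [CommRing A] [Algebra 𝕜 A] [CommRing B] [Algebra 𝕜 B]
    (f : A →ₐ[𝕜] B) (ρ : (A ⊗[𝕜] L) →ₗ[A] (A ⊗[𝕜] L) →ₗ[A] (A ⊗[𝕜] L)) :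
    L →ₗ[𝕜] L →ₗ[𝕜] (B ⊗[𝕜] L) :=
  LinearMap.mk₂ 𝕜
    (fun l l' => LinearMap.rTensor L f.toLinearMap (ρ (1 ⊗ₜ[𝕜] l) (1 ⊗ₜ[𝕜] l')))
    (fun l₁ l₂ l' => by simp [TensorProduct.tmul_add])
    (fun c l l' => by
      rw [TensorProduct.tmul_smul, ← algebraMap_smul A c, map_smul, LinearMap.smul_apply,
        algebraMap_smul, map_smul])
    (fun l l₁ l₂ => by simp [TensorProduct.tmul_add])
    (fun c l l' => by
      rw [TensorProduct.tmul_smul, ← algebraMap_smul A c, map_smul, algebraMap_smul, map_smul])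

/-- The push-out `f_* ρ`: the `B`-bilinear operation on `B ⊗ L` with
`[b ⊗ l, b' ⊗ l'] = b b' (f ⊗ id) [1 ⊗ l, 1 ⊗ l']`. -/
def pushout {A B : Type*} [CommRing A] [Algebra 𝕜 A] [CommRing B] [Algebra 𝕜 B]
    (f : A →ₐ[𝕜] B) (ρ : (A ⊗[𝕜] L) →ₗ[A] (A ⊗[𝕜] L) →ₗ[A] (A ⊗[𝕜] L)) :
    (B ⊗[𝕜] L) →ₗ[B] (B ⊗[𝕜] L) →ₗ[B] (B ⊗[𝕜] L) :=
  bilinExtend (pushoutAux f ρ)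

theorem pushout_tmul {A B : Type*} [CommRing A] [Algebra 𝕜 A] [CommRing B] [Algebra 𝕜 B]
    (f : A →ₐ[𝕜] B) (ρ : (A ⊗[𝕜] L) →ₗ[A] (A ⊗[𝕜] L) →ₗ[A] (A ⊗[𝕜] L))
    (c c' : B) (l l' : L) :
    pushout f ρ (c ⊗ₜ[𝕜] l) (c' ⊗ₜ[𝕜] l') =
      (c * c') • LinearMap.rTensor L f.toLinearMap (ρ (1 ⊗ₜ[𝕜] l) (1 ⊗ₜ[𝕜] l')) := by
  rw [pushout, bilinExtend_tmul]; rfl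

/-- The `A`-bilinear operation on `A ⊗ L` with
`[1 ⊗ l, 1 ⊗ l'] = 1 ⊗ [l, l'] + ∑ i, a i ⊗ μ i (l, l')`. -/
def perturb {A : Type*} [CommRing A] [Algebra 𝕜 A] {ι : Type*} [Fintype ι]
    (b : L →ₗ[𝕜] L →ₗ[𝕜] L) (a : ι → A) (μ : ι → L →ₗ[𝕜] L →ₗ[𝕜] L) :
    (A ⊗[𝕜] L) →ₗ[A] (A ⊗[𝕜] L) →ₗ[A] (A ⊗[𝕜] L) :=
  bilinExtend (b.compr₂ (TensorProduct.mk 𝕜 A L 1)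
    + ∑ i, (μ i).compr₂ (TensorProduct.mk 𝕜 A L (a i)))

theorem perturb_one_tmul {A : Type*} [CommRing A] [Algebra 𝕜 A] {ι : Type*} [Fintype ι]
    (b : L →ₗ[𝕜] L →ₗ[𝕜] L) (a : ι → A) (μ : ι → L →ₗ[𝕜] L →ₗ[𝕜] L) (l l' : L) :
    perturb b a μ (1 ⊗ₜ[𝕜] l) (1 ⊗ₜ[𝕜] l') =
      1 ⊗ₜ[𝕜] b l l' + ∑ i, a i ⊗ₜ[𝕜] μ i l l' := by
  rw [perturb, bilinExtend_tmul]; simp [LinearMap.sum_apply]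

/-- The base `C₁ = 𝕜 ⊕ ℍ'` of the universal infinitesimal deformation: the dual `ℍ'` of the second
cohomology `ℍ` is an ideal with zero multiplication. -/
abbrev C1 (b : L →ₗ[𝕜] L →ₗ[𝕜] L) : Type _ := TrivSqZeroExt 𝕜 (Module.Dual 𝕜 (HL2 b))

/-- The augmentation of `C₁`. -/
abbrev C1.aug (b : L →ₗ[𝕜] L →ₗ[𝕜] L) : C1 b →ₐ[𝕜] 𝕜 :=
  TrivSqZeroExt.fstHom 𝕜 𝕜 (Module.Dual 𝕜 (HL2 b))

/-- The infinitesimal deformation `η₁` with base `C₁`, for a basis `h` of the second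
cohomology and representatives `μ i` of the classes `h i`:
`[1 ⊗ l, 1 ⊗ l'] = 1 ⊗ [l, l'] + ∑ i, g i ⊗ μ i (l, l')`, where `g` is the dual basis of `h`. -/
def eta1 (b : L →ₗ[𝕜] L →ₗ[𝕜] L) {ι : Type*} [Fintype ι] (h : Module.Basis ι 𝕜 (HL2 b))
    (μ : ι → L →ₗ[𝕜] L →ₗ[𝕜] L) :
    (C1 b ⊗[𝕜] L) →ₗ[C1 b] (C1 b ⊗[𝕜] L) →ₗ[C1 b] (C1 b ⊗[𝕜] L) :=
  perturb b (fun i => (TrivSqZeroExt.inr (h.coord i) : C1 b)) μ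

/-- `η` is an infinitesimal deformation with finite dimensional base `C`, universal
among the infinitesimal deformations of `(L, b)` with finite dimensional base. -/
def IsUniversalInfinitesimal {C : Type*} [CommRing C] [Algebra 𝕜 C] (εC : C →ₐ[𝕜] 𝕜)
    (b : L →ₗ[𝕜] L →ₗ[𝕜] L)
    (η : (C ⊗[𝕜] L) →ₗ[C] (C ⊗[𝕜] L) →ₗ[C] (C ⊗[𝕜] L)) : Prop :=
  IsLocalRing C ∧ Module.Finite 𝕜 C ∧ RingHom.ker εC ^ 2 = ⊥ ∧ IsDeformation εC b η ∧
  ∀ (A : Type u) [CommRing A] [Algebra 𝕜 A] (ε : A →ₐ[𝕜] 𝕜),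
    IsLocalRing A → Module.Finite 𝕜 A → RingHom.ker ε ^ 2 = ⊥ →
    ∀ ρ : (A ⊗[𝕜] L) →ₗ[A] (A ⊗[𝕜] L) →ₗ[A] (A ⊗[𝕜] L), IsDeformation ε b ρ →
      ∃! f : C →ₐ[𝕜] A, ε.comp f = εC ∧ Equivalent ε ρ (pushout f η)

/-- `η` is a versal (formal) deformation, with complete local base `C`, of the finite
dimensional Leibniz algebra `(L, b)`. -/
def IsVersal [Module.Finite 𝕜 L] {C : Type*} [CommRing C] [Algebra 𝕜 C] (εC : C →ₐ[𝕜] 𝕜)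
    (b : L →ₗ[𝕜] L →ₗ[𝕜] L)
    (η : (C ⊗[𝕜] L) →ₗ[C] (C ⊗[𝕜] L) →ₗ[C] (C ⊗[𝕜] L)) : Prop :=
  IsCompleteLocalBase εC ∧ IsDeformation εC b η ∧
  ∀ (A : Type u) [CommRing A] [Algebra 𝕜 A] (ε : A →ₐ[𝕜] 𝕜), IsCompleteLocalBase ε →
    ∀ ρ : (A ⊗[𝕜] L) →ₗ[A] (A ⊗[𝕜] L) →ₗ[A] (A ⊗[𝕜] L), IsDeformation ε b ρ →
      (∃ f : C →ₐ[𝕜] A, ε.comp f = εC ∧ Equivalent ε ρ (pushout f η)) ∧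
      (RingHom.ker ε ^ 2 = ⊥ → ∃! f : C →ₐ[𝕜] A, ε.comp f = εC ∧ Equivalent ε ρ (pushout f η))

end Deformations

/-! ## The algebra `λ₆` and its deformations -/

section Lambda6

/-- The underlying vector space of `λ₆`. -/
abbrev L6 : Type := Fin 3 → ℂ

/-- The basis vectors: `e 0`, `e 1`, `e 2` stand for `e₁`, `e₂`, `e₃`. -/
def e (i : Fin 3) : L6 := Pi.single i 1

/-- The bilinear map sending `(e i, e j)` to `e k` and all other pairs of basis vectors to `0`. -/
def unitCochain (i j k : Fin 3) : L6 →ₗ[ℂ] L6 →ₗ[ℂ] L6 :=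
  LinearMap.smulRight (LinearMap.proj i) (LinearMap.smulRight (LinearMap.proj j) (e k))

/-- The bracket of `λ₆`: `[e₁, e₃] = e₂`, `[e₃, e₃] = e₁`, all other brackets zero. -/
def lambda6 : L6 →ₗ[ℂ] L6 →ₗ[ℂ] L6 := unitCochain 0 2 1 + unitCochain 2 2 0

/-- `μ₁ (e₂, e₃) = -e₁` and zero on all other pairs of basis vectors. -/
def mu1 : L6 →ₗ[ℂ] L6 →ₗ[ℂ] L6 := -unitCochain 1 2 0

/-- `μ₂ (e₁, e₃) = e₁` and zero on all other pairs of basis vectors. -/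
def mu2 : L6 →ₗ[ℂ] L6 →ₗ[ℂ] L6 := unitCochain 0 2 0

theorem unitCochain_e (i j k i' j' : Fin 3) :
    unitCochain i j k (e i') (e j') = if i = i' ∧ j = j' then e k else 0 := by
  by_cases h : i = i' <;> by_cases h' : j = j' <;> simp [unitCochain, e, h, h']

/-- The `A`-bilinear operation `1 ⊗ [l, l'] + t ⊗ μ₁ (l, l') + s ⊗ μ₂ (l, l')`. -/
def family {A : Type*} [CommRing A] [Algebra ℂ A] (t s : A) :
    (A ⊗[ℂ] L6) →ₗ[A] (A ⊗[ℂ] L6) →ₗ[A] (A ⊗[ℂ] L6) :=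
  perturb lambda6 ![t, s] ![mu1, mu2]

/-- The power series algebra `ℂ[[t, s]]`, with `t = tvar` and `s = svar`. -/
abbrev Cts : Type := MvPowerSeries (Fin 2) ℂ

/-- The variable `t`. -/
abbrev tvar : Cts := MvPowerSeries.X 0

/-- The variable `s`. -/
abbrev svar : Cts := MvPowerSeries.X 1

/-- The augmentation of `ℂ[[t, s]]` (constant coefficient). -/
def augTS : Cts →ₐ[ℂ] ℂ where
  toRingHom := MvPowerSeries.constantCoeff
  commutes' c := MvPowerSeries.constantCoeff_C c

/-- The augmentation of the power series algebra in one variable (constant coefficient). -/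
def augX : PowerSeries ℂ →ₐ[ℂ] ℂ where
  toRingHom := PowerSeries.constantCoeff
  commutes' c := PowerSeries.constantCoeff_C c

/-- The operation on `ℂ[[t, s]] ⊗ λ₆` given by the same formula as `η₁`. -/
def etaTS : (Cts ⊗[ℂ] L6) →ₗ[Cts] (Cts ⊗[ℂ] L6) →ₗ[Cts] (Cts ⊗[ℂ] L6) := family tvar svar

/-- The reduction of `etaTS` modulo the `(k+1)`-st power of the maximal ideal. -/
def etaTrunc (k : ℕ) := pushout (Ideal.Quotient.mkₐ ℂ (RingHom.ker augTS ^ (k + 1))) etaTS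

end Lambda6

end

end LeibnizDef

/-! The algebra `λ₆` is generated by x = e₃, since e₁ = [x,x] and e₂ = [[x,x],x], and this survives
deformation. Over a local base A put v₁ = [x,x], v₂ = [v₁,x], v₃ = [v₂,x]. Then v₁, v₂, x reduce to
a basis of `λ₆`, so they form a basis of A ⊗ L. The Leibniz identity gives [y,[x,x]] = 0, and if
[·,w] = 0 then [·,[w,x]] = 0; hence v₁, v₂, v₃ all annihilate from the right. Writing v₃ = r₀v₁ +
r₁v₂ + r₂x and evaluating [x,v₃] = 0 gives r₂ = 0. The bracket is thus determined by right
multiplication by x, and replacing v₂ by v₂ - r₁v₁ turns it into `family (-r₀) r₁`. Conversely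
`family t s` is Leibniz for all t, s, with no relation between them: this makes the base ℂ[[t,s]]
and removes all obstructions.

Uniqueness comes from two traces. In the family, [x,y] is the e₃-coordinate of y times R(x), for one
operator R with tr R = s and tr R² = s² - 2t. An equivalence conjugates R up to a factor u with ε(u)
= 1. When 𝔐² = 0 this recovers t and s; over a power series ring in one variable it separates s = 0
from s ≠ 0.

For Massey brackets, a defining system is encoded as a bracket over ℂ[[ε₁,…,εₙ]]/(εᵢ²) whose Leibniz
defect is τ times the Massey cochain, with τ = ε₁⋯εₙ in the socle. The normal form argument works
modulo τ (`exists_normal_form_mod`), and yields a genuine Leibniz bracket differing from the given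
one by τ ⊗ f. Comparing defects shows that the Massey cochain is δ(-f) (`obstruction_mem_BL3`). -/

namespace LeibnizDef

noncomputable section

/-! ## Bilinear operations on `A ⊗ λ₆` -/

section Bilinear

variable {A : Type*} [CommRing A] [Algebra ℂ A]

variable (A) in
/-- The basis `1 ⊗ e i` of `A ⊗ λ₆`. -/
def stdBasis : Module.Basis (Fin 3) A (A ⊗[ℂ] L6) :=
  (Pi.basisFun ℂ (Fin 3)).baseChange A

theorem e_apply (i j : Fin 3) : e i j = if i = j then 1 else 0 := by
  simp [e, Pi.single_apply, eq_comm]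

theorem stdBasis_apply (i : Fin 3) : stdBasis A i = 1 ⊗ₜ[ℂ] e i := by
  simp [stdBasis, e]

theorem stdBasis_repr_tmul (a : A) (v : L6) (i : Fin 3) :
    (stdBasis A).repr (a ⊗ₜ[ℂ] v) i = v i • a := by
  simp [stdBasis]

theorem bilin_ext {N : Type*} [AddCommGroup N] [Module A N]
    {ρ σ : (A ⊗[ℂ] L6) →ₗ[A] (A ⊗[ℂ] L6) →ₗ[A] N}
    (h : ∀ i j, ρ (1 ⊗ₜ[ℂ] e i) (1 ⊗ₜ[ℂ] e j) = σ (1 ⊗ₜ[ℂ] e i) (1 ⊗ₜ[ℂ] e j)) : ρ = σ := by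
  refine (stdBasis A).ext fun i => (stdBasis A).ext fun j => ?_
  simpa only [stdBasis_apply] using h i j

theorem L6_bilin_ext {N : Type*} [AddCommGroup N] [Module ℂ N] {f g : L6 →ₗ[ℂ] L6 →ₗ[ℂ] N}
    (h : ∀ i j, f (e i) (e j) = g (e i) (e j)) : f = g := by
  refine (Pi.basisFun ℂ (Fin 3)).ext fun i => (Pi.basisFun ℂ (Fin 3)).ext fun j => ?_
  simpa only [Pi.basisFun_apply, e] using h i j

@[simp] theorem augMap_tmul {L : Type*} [AddCommGroup L] [Module ℂ L] (ε : A →ₐ[ℂ] ℂ) (a : A)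
    (l : L) : augMap ε (a ⊗ₜ[ℂ] l) = ε a • l := by
  simp [augMap]

theorem augMap_smul {L : Type*} [AddCommGroup L] [Module ℂ L] (ε : A →ₐ[ℂ] ℂ) (a : A)
    (x : A ⊗[ℂ] L) : augMap ε (a • x) = ε a • augMap ε x := by
  induction x with
  | zero => simp
  | tmul b l => simp [TensorProduct.smul_tmul', mul_smul]
  | add x y hx hy => simp only [smul_add, map_add, hx, hy]

theorem augMap_apply (ε : A →ₐ[ℂ] ℂ) (x : A ⊗[ℂ] L6) (i : Fin 3) :
    augMap ε x i = ε ((stdBasis A).repr x i) := by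
  induction x with
  | zero => simp
  | tmul b l => simp [stdBasis_repr_tmul, mul_comm]
  | add x y hx hy => simp only [map_add, Pi.add_apply, Finsupp.add_apply, hx, hy]

theorem augMap_hom_of_basis {ε : A →ₐ[ℂ] ℂ} {b : L6 →ₗ[ℂ] L6 →ₗ[ℂ] L6}
    {ρ : (A ⊗[ℂ] L6) →ₗ[A] (A ⊗[ℂ] L6) →ₗ[A] (A ⊗[ℂ] L6)}
    (h : ∀ i j, augMap ε (ρ (1 ⊗ₜ[ℂ] e i) (1 ⊗ₜ[ℂ] e j)) = b (e i) (e j)) (x y : A ⊗[ℂ] L6) :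
    augMap ε (ρ x y) = b (augMap ε x) (augMap ε y) := by
  have hx := (stdBasis A).sum_repr x
  have hy := (stdBasis A).sum_repr y
  rw [← hx, ← hy]
  simp only [map_sum, map_smul, LinearMap.sum_apply, LinearMap.smul_apply, augMap_smul, h,
    stdBasis_apply, augMap_tmul, map_one, one_smul]

theorem isLeibniz_iff_circ {R : Type*} [CommRing R] {M : Type*} [AddCommGroup M] [Module R M]
    (b : M →ₗ[R] M →ₗ[R] M) : IsLeibniz b ↔ circ b b = 0 := by
  constructor
  · intro h
    ext x y z
    rw [circ_apply, h x y z]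
    simp
  · intro h x y z
    have := congr($h x y z)
    rw [circ_apply] at this
    exact (sub_eq_zero.1 this).symm

/-- This is d = [b,·] in the differential graded Lie algebra: it identifies the terms linear in f in
the Leibniz defect of b + f with -δf. -/
theorem superBracket_eq_neg_delta2 {R : Type*} [CommRing R] {M : Type*} [AddCommGroup M]
    [Module R M] (b f : M →ₗ[R] M →ₗ[R] M) : superBracket b f = -delta2 b f := by
  ext x y z
  simp only [superBracket, LinearMap.add_apply, LinearMap.neg_apply, circ_apply, delta2_apply]
  abel

end Bilinear

/-! ## The family of brackets -/

section Family

variable {A : Type*} [CommRing A] [Algebra ℂ A]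

theorem lambda6_apply (x y : L6) : lambda6 x y = y 2 • ![x 2, x 0, 0] := by
  ext i; fin_cases i <;> simp [lambda6, unitCochain, e, mul_comm]

theorem mu1_apply (x y : L6) : mu1 x y = y 2 • ![-x 1, 0, 0] := by
  ext i; fin_cases i <;> simp [mu1, unitCochain, e, mul_comm]

theorem mu2_apply (x y : L6) : mu2 x y = y 2 • ![x 0, 0, 0] := by
  ext i; fin_cases i <;> simp [mu2, unitCochain, e, mul_comm]

theorem isLeibniz_lambda6 : IsLeibniz lambda6 := by
  intro x y z
  ext i; fin_cases i <;> simp [lambda6_apply]; ring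

theorem mu1_mem_ZL2 : mu1 ∈ ZL2 lambda6 := by
  refine LinearMap.ext fun x => LinearMap.ext fun y => LinearMap.ext fun z => ?_
  rw [delta2_apply]
  ext i; fin_cases i <;> simp [lambda6_apply, mu1_apply] <;> ring

theorem mu2_mem_ZL2 : mu2 ∈ ZL2 lambda6 := by
  refine LinearMap.ext fun x => LinearMap.ext fun y => LinearMap.ext fun z => ?_
  rw [delta2_apply]
  ext i; fin_cases i <;> simp [lambda6_apply, mu2_apply] <;> ring

theorem superBracket_mu1_mu1 : superBracket mu1 mu1 = 0 := by
  refine LinearMap.ext fun x => LinearMap.ext fun y => LinearMap.ext fun z => ?_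
  simp only [superBracket, LinearMap.add_apply, circ_apply]
  ext i; fin_cases i <;> simp [mu1_apply]

theorem superBracket_mu1_mu2 : superBracket mu1 mu2 = 0 := by
  refine LinearMap.ext fun x => LinearMap.ext fun y => LinearMap.ext fun z => ?_
  simp only [superBracket, LinearMap.add_apply, circ_apply]
  ext i; fin_cases i <;> simp [mu1_apply, mu2_apply]; ring

theorem superBracket_mu2_mu2 : superBracket mu2 mu2 = 0 := by
  refine LinearMap.ext fun x => LinearMap.ext fun y => LinearMap.ext fun z => ?_
  simp only [superBracket, LinearMap.add_apply, circ_apply]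
  ext i; fin_cases i <;> simp [mu2_apply]; ring

/-- Right multiplication by `1 ⊗ e₃` for the bracket `family t s`. -/
def rightMul (t s : A) : (A ⊗[ℂ] L6) →ₗ[A] (A ⊗[ℂ] L6) :=
  (stdBasis A).constr A ![1 ⊗ₜ[ℂ] e 1 + s ⊗ₜ[ℂ] e 0, -(t ⊗ₜ[ℂ] e 0), 1 ⊗ₜ[ℂ] e 0]

theorem rightMul_basis (t s : A) (i : Fin 3) : rightMul t s (1 ⊗ₜ[ℂ] e i) =
    ![1 ⊗ₜ[ℂ] e 1 + s ⊗ₜ[ℂ] e 0, -(t ⊗ₜ[ℂ] e 0), 1 ⊗ₜ[ℂ] e 0] i := by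
  rw [rightMul, ← stdBasis_apply i, Module.Basis.constr_basis]

theorem family_basis (t s : A) (i j : Fin 3) :
    family t s (1 ⊗ₜ[ℂ] e i) (1 ⊗ₜ[ℂ] e j) =
      if j = 2 then rightMul t s (1 ⊗ₜ[ℂ] e i) else 0 := by
  rw [family, perturb_one_tmul, rightMul_basis]
  fin_cases i <;> fin_cases j <;>
    simp [lambda6, mu1, mu2, unitCochain_e, TensorProduct.tmul_neg]

/-- The second argument enters only through its e₃-coordinate, so a member of the family amounts to
a single operator; the Leibniz identity and the invariants below are read off from it. -/
theorem family_apply (t s : A) (x y : A ⊗[ℂ] L6) :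
    family t s x y = (stdBasis A).repr y 2 • rightMul t s x := by
  have : family t s = 
      (((stdBasis A).coord 2).smulRight (rightMul t s)).flip := by
    refine bilin_ext fun i j => ?_
    rw [family_basis]
    simp only [LinearMap.flip_apply, LinearMap.smulRight_apply, LinearMap.smul_apply,
      Module.Basis.coord_apply, stdBasis_repr_tmul]
    fin_cases j <;> simp [e]
  rw [this]; rfl

theorem repr_two_rightMul (t s : A) (x : A ⊗[ℂ] L6) :
    (stdBasis A).repr (rightMul t s x) 2 = 0 := by
  have : (stdBasis A).coord 2 ∘ₗ rightMul t s = 0 := by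
    refine (stdBasis A).ext fun i => ?_
    rw [stdBasis_apply, LinearMap.comp_apply, rightMul_basis, Module.Basis.coord_apply]
    fin_cases i <;> simp [stdBasis_repr_tmul, e]
  exact congr($this x)

/-- The image of R = `rightMul t s` has no e₃-component, so [x,[y,z]] = 0, while [[x,y],z] is R²x
times the product of the e₃-coordinates of y and z, which is symmetric in y and z. -/
theorem isLeibniz_family (t s : A) : IsLeibniz (family t s) := by
  intro x y z
  simp only [family_apply, map_smul, LinearMap.smul_apply, repr_two_rightMul, smul_zero,
    zero_smul]
  rw [smul_comm, sub_self]

theorem isDeformation_family {ε : A →ₐ[ℂ] ℂ} {t s : A} (ht : ε t = 0) (hs : ε s = 0) :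
    IsDeformation ε lambda6 (family t s) where
  isLeibniz := isLeibniz_family t s
  augMap_hom := by
    refine augMap_hom_of_basis fun i j => ?_
    rw [family, perturb_one_tmul]
    simp [Fin.sum_univ_two, ht, hs]

theorem pushout_family {B : Type*} [CommRing B] [Algebra ℂ B] (f : A →ₐ[ℂ] B) (t s : A) :
    pushout f (family t s) = family (f t) (f s) := by
  refine bilin_ext fun i j => ?_
  rw [pushout_tmul, family, family, perturb_one_tmul, perturb_one_tmul]
  simp [Fin.sum_univ_two]

end Family

/-! ## Equivalences and the normal form -/

section NormalForm

variable {A : Type*} [CommRing A] [Algebra ℂ A]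

theorem Equivalent.symm {ε : A →ₐ[ℂ] ℂ}
    {ρ σ : (A ⊗[ℂ] L6) →ₗ[A] (A ⊗[ℂ] L6) →ₗ[A] (A ⊗[ℂ] L6)}
    (h : Equivalent ε ρ σ) : Equivalent ε σ ρ := by
  obtain ⟨φ, h1, h2⟩ := h
  refine ⟨φ.symm, fun x y => ?_, fun x => ?_⟩
  · rw [LinearEquiv.symm_apply_eq, h1]; simp
  · rw [← h2 (φ.symm x)]; simp

theorem Equivalent.trans {ε : A →ₐ[ℂ] ℂ}
    {ρ σ τ : (A ⊗[ℂ] L6) →ₗ[A] (A ⊗[ℂ] L6) →ₗ[A] (A ⊗[ℂ] L6)}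
    (h : Equivalent ε ρ σ) (h' : Equivalent ε σ τ) : Equivalent ε ρ τ := by
  obtain ⟨φ, h1, h2⟩ := h
  obtain ⟨ψ, h3, h4⟩ := h'
  exact ⟨φ.trans ψ, fun x y => by simp [h1, h3], fun x => by simp [h2, h4]⟩

theorem isUnit_of_aug_eq_one [IsLocalRing A] (ε : A →ₐ[ℂ] ℂ) {a : A} (ha : ε a = 1) :
    IsUnit a := by
  by_contra h
  rcases IsLocalRing.isUnit_or_isUnit_of_add_one (a := a) (b := 1 - a) (by ring) with h' | h'
  · exact h h'
  · have := h'.map ε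
    simp [ha] at this

/-- The matrix of ψ reduces to the identity under ε, so its determinant reduces to 1 and is a unit
of the local ring. -/
theorem isUnit_det_of_augMap_comp [IsLocalRing A] (ε : A →ₐ[ℂ] ℂ)
    (ψ : (A ⊗[ℂ] L6) →ₗ[A] (A ⊗[ℂ] L6))
    (h : ∀ i, augMap ε (ψ (1 ⊗ₜ[ℂ] e i)) = e i) :
    IsUnit (LinearMap.toMatrix (stdBasis A) (stdBasis A) ψ).det := by
  refine isUnit_of_aug_eq_one ε ?_
  rw [AlgHom.map_det]
  have : ε.mapMatrix (LinearMap.toMatrix (stdBasis A) (stdBasis A) ψ) = 1 := by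
    ext i j
    have := congr($(h j) i)
    rw [augMap_apply] at this
    simp [LinearMap.toMatrix_apply, stdBasis_apply, this, e_apply, Matrix.one_apply, eq_comm]
  rw [this, Matrix.det_one]

/-- Vectors reducing to the standard basis of `λ₆` are the image of the standard basis under an
automorphism which is compatible with the augmentation. -/
theorem exists_equiv_of_augMap [IsLocalRing A] (ε : A →ₐ[ℂ] ℂ) (v : Fin 3 → A ⊗[ℂ] L6)
    (hv : ∀ i, augMap ε (v i) = e i) :
    ∃ φ : (A ⊗[ℂ] L6) ≃ₗ[A] (A ⊗[ℂ] L6), (∀ i, φ (1 ⊗ₜ[ℂ] e i) = v i) ∧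
      ∀ x, augMap ε (φ x) = augMap ε x := by
  let ψ : (A ⊗[ℂ] L6) →ₗ[A] (A ⊗[ℂ] L6) := (stdBasis A).constr A v
  have hψ : ∀ i, ψ (1 ⊗ₜ[ℂ] e i) = v i := fun i => by
    rw [← stdBasis_apply, Module.Basis.constr_basis]
  have hu := isUnit_det_of_augMap_comp ε ψ fun i => by rw [hψ, hv]
  refine ⟨LinearEquiv.ofIsUnitDet hu, hψ, fun x => ?_⟩
  change augMap ε (ψ x) = _
  rw [← (stdBasis A).sum_repr x]
  simp only [map_sum, map_smul, augMap_smul, stdBasis_apply, hψ, hv, augMap_tmul, map_one, one_smul]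

omit [Algebra ℂ A] in
theorem map_mem_smul_top {M N : Type*} [AddCommGroup M] [Module A M] [AddCommGroup N] [Module A N]
    {I : Ideal A} (f : M →ₗ[A] N) {x : M} (hx : x ∈ I • (⊤ : Submodule A M)) :
    f x ∈ I • (⊤ : Submodule A N) := by
  have : f x ∈ (I • (⊤ : Submodule A M)).map f := Submodule.mem_map_of_mem hx
  rw [Submodule.map_smul''] at this
  exact Submodule.smul_mono le_rfl le_top this

/-- Normal form modulo an ideal `I`: if `ρ` reduces to the bracket of `λ₆` and satisfies the Leibniz
identity modulo `I`, then modulo `I` it is equivalent to a member of the family. -/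
theorem exists_normal_form_mod [IsLocalRing A] {ε : A →ₐ[ℂ] ℂ} (I : Ideal A)
    {ρ : (A ⊗[ℂ] L6) →ₗ[A] (A ⊗[ℂ] L6) →ₗ[A] (A ⊗[ℂ] L6)}
    (haug : ∀ x y, augMap ε (ρ x y) = lambda6 (augMap ε x) (augMap ε y))
    (hρ : ∀ x y z, circ ρ ρ x y z ∈ I • (⊤ : Submodule A (A ⊗[ℂ] L6))) :
    ∃ (t s : A) (φ : (A ⊗[ℂ] L6) ≃ₗ[A] (A ⊗[ℂ] L6)), ε t = 0 ∧ ε s = 0 ∧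
      (∀ x, augMap ε (φ x) = augMap ε x) ∧
      ∀ x y, ρ (φ x) (φ y) - φ (family t s x y) ∈ I • (⊤ : Submodule A (A ⊗[ℂ] L6)) := by
  set N : Submodule A (A ⊗[ℂ] L6) := I • ⊤ with hN
  set x : A ⊗[ℂ] L6 := 1 ⊗ₜ e 2 with hx
  set v₁ := ρ x x with hv₁
  set v₂ := ρ v₁ x with hv₂
  set v₃ := ρ v₂ x with hv₃
  have hl : ∀ i j, lambda6 (e i) (e j) =
      if j = 2 then ![e 1, 0, e 0] i else 0 := by
    intro i j
    fin_cases i <;> fin_cases j <;> simp [lambda6, unitCochain_e]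
  have ex : augMap ε x = e 2 := by simp [hx]
  have e1 : augMap ε v₁ = e 0 := by simp [hv₁, haug, ex, hl]
  have e2 : augMap ε v₂ = e 1 := by simp [hv₂, haug, e1, ex, hl]
  have e3 : augMap ε v₃ = 0 := by simp [hv₃, haug, e2, ex, hl]
  obtain ⟨ψ, hψ, hψε⟩ := exists_equiv_of_augMap ε ![v₁, v₂, x]
    (by intro i; fin_cases i <;> simp [ex, e1, e2])
  set r := (stdBasis A).repr (ψ.symm v₃) with hr
  have hεr : ∀ i, ε (r i) = 0 := fun i => by
    rw [hr, ← augMap_apply, ← hψε, LinearEquiv.apply_symm_apply, e3]; rfl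
  have hv : v₃ = r 0 • v₁ + r 1 • v₂ + r 2 • x := by
    have h := congr(ψ $((stdBasis A).sum_repr (ψ.symm v₃)))
    rw [LinearEquiv.apply_symm_apply, map_sum, Fin.sum_univ_three] at h
    simpa [stdBasis_apply, hψ] using h.symm
  -- With v₂' = v₂ - r₁v₁ one has [v₁,x] = v₂' + r₁v₁, and [v₂',x] = v₃ - r₁v₂, which is r₀v₁ up to
  -- the multiple r₂x. Hence s = r₁ and t = -r₀.
  obtain ⟨φ, hφ, hφε⟩ := exists_equiv_of_augMap ε ![v₁, v₂ - r 1 • v₁, x]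
    (by intro i; fin_cases i <;> simp [ex, e1, e2, augMap_smul, hεr])
  have hNl : ∀ {u} (w), u ∈ N → ρ u w ∈ N := fun w hu => map_mem_smul_top (ρ.flip w) hu
  have h1 : ∀ y, ρ y v₁ ∈ N := fun y => by
    have := hρ y x x
    rw [circ_apply, sub_self, zero_sub] at this
    simpa using N.neg_mem this
  -- Modulo N, [y,[w,x]] = [[y,w],x] - [[y,x],w], and both terms on the right vanish.
  have step : ∀ {w : A ⊗[ℂ] L6}, (∀ y, ρ y w ∈ N) → ∀ y, ρ y (ρ w x) ∈ N := by
    intro w hw y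
    have := hρ y w x
    rw [circ_apply] at this
    have h' := N.sub_mem (N.sub_mem (hNl x (hw y)) (hw (ρ y x))) this
    simpa using h'
  have h2 := step h1
  have h3 := step h2
  rw [← hv₂] at h2 h3
  rw [← hv₃] at h3
  -- Modulo N, [x,v₃] vanishes and also equals r₂[x,x] = r₂v₁; since v₁ is a basis vector, r₂ lies
  -- in I.
  have hc : r 2 ∈ I := by
    have h4 : r 2 • v₁ ∈ N := by
      have h5 := h3 x
      rw [hv, map_add, map_add, map_smul, map_smul, map_smul] at h5
      have h6 := N.sub_mem h5 (N.add_mem (N.smul_mem (r 0) (h1 x)) (N.smul_mem (r 1) (h2 x)))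
      simpa using h6
    have h5 := map_mem_smul_top ((stdBasis A).coord 0 ∘ₗ ψ.symm.toLinearMap) h4
    have h6 : ψ.symm v₁ = 1 ⊗ₜ e 0 := by rw [LinearEquiv.symm_apply_eq, hψ]; rfl
    simpa [h6, stdBasis_repr_tmul, e_apply] using h5
  refine ⟨-r 0, r 1, φ, by simp [hεr], hεr 1, hφε, ?_⟩
  have key : (ρ.compl₁₂ φ.toLinearMap φ.toLinearMap).compr₂ N.mkQ =
      ((family (-r 0) (r 1)).compr₂ φ.toLinearMap).compr₂ N.mkQ := by
    refine bilin_ext fun i j => ?_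
    simp only [LinearMap.compr₂_apply, LinearMap.compl₁₂_apply, LinearEquiv.coe_coe, hφ]
    rw [Submodule.mkQ_apply, Submodule.mkQ_apply, Submodule.Quotient.eq, family_basis,
      rightMul_basis]
    have t1 : ∀ (a : A) (i : Fin 3), a ⊗ₜ[ℂ] e i = a • ((1 : A) ⊗ₜ[ℂ] e i) := fun a i => by
      simp [TensorProduct.smul_tmul']
    have hj : j = 0 ∨ j = 1 ∨ j = 2 := by fin_cases j <;> simp
    rcases hj with rfl | rfl | rfl
    · simpa using h1 _
    · simpa using N.sub_mem (h2 _) (N.smul_mem _ (h1 _))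
    · rw [if_pos rfl]
      fin_cases i
      · simp [t1 (r 1), hφ, ← hv₂]
      · have : v₃ - r 1 • v₂ - r 0 • v₁ ∈ N := by
          rw [hv]
          have : r 0 • v₁ + r 1 • v₂ + r 2 • x - r 1 • v₂ - r 0 • v₁ = r 2 • x := by abel
          rw [this]
          exact Submodule.smul_mem_smul hc trivial
        have hn : (-r 0) • v₁ = -(r 0 • v₁) := neg_smul (r 0) v₁
        rw [sub_eq_add_neg, ← hn] at this
        simpa [t1 (-r 0), hφ, ← hv₂, ← hv₃] using this
      · simp [hφ, ← hv₁]
  intro a b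
  have := congr($key a b)
  simpa [Submodule.Quotient.eq] using this

theorem exists_equivalent_family [IsLocalRing A] {ε : A →ₐ[ℂ] ℂ}
    {ρ : (A ⊗[ℂ] L6) →ₗ[A] (A ⊗[ℂ] L6) →ₗ[A] (A ⊗[ℂ] L6)} (h : IsDeformation ε lambda6 ρ) :
    ∃ t s : A, ε t = 0 ∧ ε s = 0 ∧ Equivalent ε ρ (family t s) := by
  obtain ⟨t, s, φ, ht, hs, hφ, H⟩ := exists_normal_form_mod ⊥ h.augMap_hom (fun x y z => by
    rw [(isLeibniz_iff_circ ρ).1 h.isLeibniz]; simp)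
  refine ⟨t, s, ht, hs, Equivalent.symm ⟨φ, fun x y => ?_, hφ⟩⟩
  have := H x y
  rw [Submodule.bot_smul, Submodule.mem_bot, sub_eq_zero] at this
  exact this.symm

/-- Together with the trace of the square, this recovers s and t from the conjugacy class of the
operator, 2 being invertible. -/
theorem trace_rightMul (t s : A) : LinearMap.trace A _ (rightMul t s) = s := by
  rw [LinearMap.trace_eq_matrix_trace A (stdBasis A), Matrix.trace, Fin.sum_univ_three]
  simp [LinearMap.toMatrix_apply, stdBasis_apply, rightMul_basis, stdBasis_repr_tmul, e_apply]

theorem trace_rightMul_sq (t s : A) :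
    LinearMap.trace A _ (rightMul t s ∘ₗ rightMul t s) = s ^ 2 - 2 * t := by
  have t1 : ∀ (a : A) (i : Fin 3), a ⊗ₜ[ℂ] e i = a • ((1 : A) ⊗ₜ[ℂ] e i) := fun a i => by
    simp [TensorProduct.smul_tmul']
  rw [LinearMap.trace_eq_matrix_trace A (stdBasis A), Matrix.trace, Fin.sum_univ_three]
  simp only [Matrix.diag_apply, LinearMap.toMatrix_apply, stdBasis_apply, LinearMap.comp_apply,
    rightMul_basis]
  simp [t1 s, t1 t, rightMul_basis, stdBasis_repr_tmul, e_apply]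
  ring

/-- Equivalent members of the family differ by rescaling the parameters. -/
theorem exists_scale_of_equivalent_family {ε : A →ₐ[ℂ] ℂ} {t s t' s' : A}
    (h : Equivalent ε (family t s) (family t' s')) :
    ∃ u : A, ε u = 1 ∧ s = u * s' ∧ s ^ 2 - 2 * t = u ^ 2 * (s' ^ 2 - 2 * t') := by
  obtain ⟨φ, h1, h2⟩ := h
  set u := (stdBasis A).repr (φ (1 ⊗ₜ[ℂ] e 2)) 2 with hu
  -- Only the e₃-coordinate u of φ(e₃) is seen by the second bracket, so bracketing with e₃ on the
  -- right gives φ R = u R' φ.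
  have hc : rightMul t s = φ.symm.conj (u • rightMul t' s') := by
    refine LinearMap.ext fun y => ?_
    have := h1 y (1 ⊗ₜ[ℂ] e 2)
    rw [family_apply, family_apply, stdBasis_repr_tmul] at this
    rw [LinearEquiv.conj_apply_apply, LinearEquiv.eq_symm_apply]
    simpa [e_apply] using this
  refine ⟨u, ?_, ?_, ?_⟩
  · rw [hu, ← augMap_apply, h2]; simp [e_apply]
  · have := congr(LinearMap.trace A _ $hc)
    rwa [LinearMap.trace_conj', trace_rightMul, map_smul, trace_rightMul] at this
  · have := trace_rightMul_sq t s
    rw [hc, ← LinearEquiv.conj_comp, LinearMap.trace_conj', LinearMap.smul_comp,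
      LinearMap.comp_smul, smul_smul, map_smul, trace_rightMul_sq] at this
    rw [← this, smul_eq_mul, sq u]

/-- Here u - 1 lies in 𝔐 and 𝔐² = 0, so the scaling by u has no effect on parameters in 𝔐, and the
squares of s and s' disappear from the second trace. -/
theorem eq_of_equivalent_family {ε : A →ₐ[ℂ] ℂ} (hε : RingHom.ker ε ^ 2 = ⊥) {t s t' s' : A}
    (ht' : ε t' = 0) (hs : ε s = 0) (hs' : ε s' = 0)
    (h : Equivalent ε (family t s) (family t' s')) : t = t' ∧ s = s' := by
  obtain ⟨u, hu, h1, h2⟩ := exists_scale_of_equivalent_family h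
  have hz : ∀ {a b : A}, ε a = 0 → ε b = 0 → a * b = 0 := fun {a b} ha hb => by
    have : a * b ∈ RingHom.ker ε ^ 2 := by
      rw [sq]; exact Ideal.mul_mem_mul ha hb
    rwa [hε] at this
  have hm : ε (u - 1) = 0 := by simp [hu]
  refine ⟨?_, by linear_combination h1 + hz hm hs'⟩
  have h3 : (2 : A) * (t - t') = 0 := by
    linear_combination hz hs hs - h2 - u ^ 2 * hz hs' hs' + 2 * (u + 1) * hz hm ht'
  have h4 : ((1 / 2 : ℂ) • (2 : A)) = 1 := by
    rw [Algebra.smul_def, ← map_ofNat (algebraMap ℂ A) 2, ← map_mul]; norm_num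
  have h5 := congr((1 / 2 : ℂ) • $h3)
  rw [← smul_mul_assoc, h4, one_mul, smul_zero] at h5
  exact sub_eq_zero.1 h5

end NormalForm

/-! ## Power series -/

section PowerSeries

/-- Power series are evaluated in the I-adic topology of A, with R discrete: elements of I are
topologically nilpotent and A is complete. -/
theorem exists_algHom_mvPowerSeries {R σ A : Type*} [CommRing R] [Finite σ] [CommRing A]
    [Algebra R A] (I : Ideal A) [IsAdicComplete I A] (a : σ → A) (ha : ∀ i, a i ∈ I) :
    ∃ f : MvPowerSeries σ R →ₐ[R] A, ∀ i, f (MvPowerSeries.X i) = a i := by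
  let _ : UniformSpace R := ⊥
  have _ : DiscreteTopology R := ⟨rfl⟩
  let _ : WithIdeal A := ⟨I⟩
  have hI : IsAdic I := rfl
  obtain ⟨_, _⟩ := hI.isAdicComplete_iff.1 inferInstance
  have _ : IsUniformAddGroup R := inferInstance
  have _ : ContinuousSMul R A := continuousSMul_of_algebraMap R A continuous_of_discreteTopology
  have hev : MvPowerSeries.HasEval a :=
    { hpow := fun i => WithIdeal.isTopologicallyNilpotent_of_mem (ha i)
      tendsto_zero := by simp [Filter.cofinite_eq_bot] }
  exact ⟨MvPowerSeries.aeval hev, fun i => by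
    rw [← MvPolynomial.coe_X, MvPowerSeries.aeval_coe, MvPolynomial.aeval_X]⟩

theorem mem_span_X_of_constantCoeff_eq_zero {R σ : Type*} [CommRing R] [Finite σ]
    {p : MvPowerSeries σ R} (hp : MvPowerSeries.constantCoeff p = 0) :
    p ∈ Ideal.span (Set.range (MvPowerSeries.X : σ → MvPowerSeries σ R)) := by
  classical
  cases nonempty_fintype σ
  -- Variables are removed one at a time: p is assumed to have no monomial free of all the variables
  -- in S.
  have key : ∀ (S : Finset σ) (p : MvPowerSeries σ R),
      (∀ m : σ →₀ ℕ, (∀ i ∈ S, m i = 0) → MvPowerSeries.coeff m p = 0) →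
      p ∈ Ideal.span (Set.range (MvPowerSeries.X : σ → MvPowerSeries σ R)) := by
    intro S
    induction S using Finset.induction_on with
    | empty =>
      intro p h
      have : p = 0 := MvPowerSeries.ext fun m => by rw [h m (by simp)]; simp
      rw [this]; exact Ideal.zero_mem _
    | insert a S _ ih =>
      intro p h
      -- The part of p free of the variable a. The rest is divisible by that variable, and q
      -- satisfies the hypothesis for the smaller S.
      let q : MvPowerSeries σ R := fun m => if m a = 0 then MvPowerSeries.coeff m p else 0
      have hq : ∀ m, MvPowerSeries.coeff m q =
          if m a = 0 then MvPowerSeries.coeff m p else 0 := fun _ => rfl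
      have h1 : q ∈ Ideal.span (Set.range (MvPowerSeries.X : σ → MvPowerSeries σ R)) := by
        refine ih q fun m hm => ?_
        rw [hq]
        split_ifs with h0
        · exact h m fun i hi => by
            rcases Finset.mem_insert.1 hi with rfl | hi
            · exact h0
            · exact hm i hi
        · rfl
      have h2 : MvPowerSeries.X a ∣ p - q := by
        rw [MvPowerSeries.X_dvd_iff]
        intro m hm
        rw [map_sub, hq, if_pos hm, sub_self]
      have h3 := Ideal.mem_of_dvd _ h2 (Ideal.subset_span (Set.mem_range_self a))
      have := Ideal.add_mem _ h3 h1
      rwa [sub_add_cancel] at this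
  refine key Finset.univ p fun m hm => ?_
  have : m = 0 := Finsupp.ext fun i => hm i (Finset.mem_univ i)
  rw [this]; exact hp

theorem ker_augTS : RingHom.ker augTS =
    Ideal.span (Set.range (MvPowerSeries.X : Fin 2 → Cts)) := by
  refine le_antisymm (fun p hp => mem_span_X_of_constantCoeff_eq_zero hp) ?_
  rw [Ideal.span_le]
  rintro _ ⟨i, rfl⟩
  exact MvPowerSeries.constantCoeff_X i

theorem augTS_X (i : Fin 2) : augTS (MvPowerSeries.X i) = 0 := MvPowerSeries.constantCoeff_X i

instance : IsAdicComplete (RingHom.ker augTS) Cts := by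
  rw [ker_augTS]; infer_instance

theorem ker_augX : RingHom.ker augX = Ideal.span {PowerSeries.X} := by
  ext p
  rw [Ideal.mem_span_singleton, PowerSeries.X_dvd_iff]
  rfl

instance : IsAdicComplete (RingHom.ker augX) (PowerSeries ℂ) := by
  rw [ker_augX]; infer_instance

/-- Modulo the square of the maximal ideal, a power series is determined by its constant and linear
terms. -/
theorem exists_linear_part (p : Cts) : ∃ c a b : ℂ, ∃ q ∈ RingHom.ker augTS ^ 2,
    p = algebraMap ℂ Cts c + a • tvar + b • svar + q := by
  have dec : ∀ p : Cts, ∃ x y : Cts, p = algebraMap ℂ Cts (augTS p) + x * tvar + y * svar := by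
    intro p
    have : p - algebraMap ℂ Cts (augTS p) ∈ RingHom.ker augTS := by
      rw [RingHom.mem_ker, map_sub, AlgHom.commutes]; exact sub_self _
    rw [ker_augTS, Ideal.mem_span_range_iff_exists_fun] at this
    obtain ⟨c, hc⟩ := this
    rw [Fin.sum_univ_two] at hc
    exact ⟨c 0, c 1, by linear_combination -hc⟩
  obtain ⟨x, y, hp⟩ := dec p
  refine ⟨augTS p, augTS x, augTS y, (x - algebraMap ℂ Cts (augTS x)) * tvar +
    (y - algebraMap ℂ Cts (augTS y)) * svar, ?_, ?_⟩
  · have h : ∀ x : Cts, x - algebraMap ℂ Cts (augTS x) ∈ RingHom.ker augTS := fun x => by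
      rw [RingHom.mem_ker, map_sub, AlgHom.commutes]; exact sub_self _
    rw [sq]
    exact Ideal.add_mem _ (Ideal.mul_mem_mul (h x) (augTS_X 0))
      (Ideal.mul_mem_mul (h y) (augTS_X 1))
  · conv_lhs => rw [hp]
    rw [Algebra.smul_def, Algebra.smul_def]
    ring

/-- No continuity of f is needed: the maximal ideal is generated algebraically by the two variables,
so its image under ε ∘ f is zero. -/
theorem aug_comp_eq_augTS {A : Type*} [CommRing A] [Algebra ℂ A] {ε : A →ₐ[ℂ] ℂ}
    {f : Cts →ₐ[ℂ] A} (ht : ε (f tvar) = 0) (hs : ε (f svar) = 0) : ε.comp f = augTS := by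
  have hle : RingHom.ker augTS ≤ RingHom.ker (ε.comp f) := by
    rw [ker_augTS, Ideal.span_le]
    rintro _ ⟨i, rfl⟩
    fin_cases i
    · exact ht
    · exact hs
  ext p
  have : p - algebraMap ℂ Cts (augTS p) ∈ RingHom.ker augTS := by
    rw [RingHom.mem_ker, map_sub, AlgHom.commutes]; exact sub_self _
  have h := hle this
  rw [RingHom.mem_ker, map_sub, AlgHom.commutes, sub_eq_zero] at h
  exact h

theorem map_ker_augTS_sq {A : Type*} [CommRing A] [Algebra ℂ A] {ε : A →ₐ[ℂ] ℂ}
    (hε : RingHom.ker ε ^ 2 = ⊥) {f : Cts →ₐ[ℂ] A} (hf : ε.comp f = augTS) {q : Cts}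
    (hq : q ∈ RingHom.ker augTS ^ 2) : f q = 0 := by
  have hle : RingHom.ker augTS ≤ (RingHom.ker ε).comap f := fun x hx => by
    rw [Ideal.mem_comap, RingHom.mem_ker, ← AlgHom.comp_apply, hf]; exact hx
  have h1 := Ideal.pow_right_mono hle 2 hq
  have h2 := Ideal.le_comap_pow f 2 h1
  rwa [hε, Ideal.mem_comap, Ideal.mem_bot] at h2

/-- Both maps kill the square of the maximal ideal, so only constant and linear terms matter. This
gives uniqueness among all homomorphisms, not only continuous ones. -/
theorem algHom_ext_of_sq_eq_bot {A : Type*} [CommRing A] [Algebra ℂ A] {ε : A →ₐ[ℂ] ℂ}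
    (hε : RingHom.ker ε ^ 2 = ⊥) {f g : Cts →ₐ[ℂ] A} (hf : ε.comp f = augTS)
    (hg : ε.comp g = augTS) (ht : f tvar = g tvar) (hs : f svar = g svar) : f = g := by
  ext p
  obtain ⟨c, a, b, q, hq, rfl⟩ := exists_linear_part p
  simp only [map_add, map_smul, AlgHom.commutes, ht, hs, map_ker_augTS_sq hε hf hq,
    map_ker_augTS_sq hε hg hq]

/-- The ring acts on N through ε, so generators over A already generate over ℂ. -/
theorem finite_of_ker_smul_eq_bot {A : Type*} [CommRing A] [Algebra ℂ A] (ε : A →ₐ[ℂ] ℂ)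
    {N : Type*} [AddCommGroup N] [Module A N] [Module ℂ N] [IsScalarTower ℂ A N]
    [Module.Finite A N] (h : ∀ a ∈ RingHom.ker ε, ∀ x : N, a • x = 0) : Module.Finite ℂ N := by
  obtain ⟨S, hS⟩ := Module.Finite.fg_top (R := A) (M := N)
  refine ⟨⟨S, ?_⟩⟩
  rw [eq_top_iff]
  rintro x -
  have hx : x ∈ Submodule.span A (S : Set N) := by rw [hS]; trivial
  induction hx using Submodule.span_induction with
  | mem x hx => exact Submodule.subset_span hx
  | zero => exact Submodule.zero_mem _
  | add x y _ _ hx hy => exact Submodule.add_mem _ hx hy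
  | smul a x _ hx =>
    have h0 := h (a - algebraMap ℂ A (ε a)) (by simp) x
    rw [sub_smul, algebraMap_smul, sub_eq_zero] at h0
    rw [h0]
    exact Submodule.smul_mem _ _ hx

theorem isCompleteLocalBase_augTS : IsCompleteLocalBase augTS where
  isLocalRing := inferInstance
  isAdicComplete := inferInstance
  finite_pow_quotient k := by
    have hfg : (RingHom.ker augTS ^ k).FG := by
      rw [ker_augTS]
      exact Ideal.FG.pow (Submodule.fg_span (Set.finite_range _))
    have : Module.Finite Cts ↥(RingHom.ker augTS ^ k) := Module.Finite.iff_fg.2 hfg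
    refine finite_of_ker_smul_eq_bot augTS fun a ha x => ?_
    obtain ⟨y, rfl⟩ := Submodule.Quotient.mk_surjective _ x
    rw [← Submodule.Quotient.mk_smul, Submodule.Quotient.mk_eq_zero]
    exact Submodule.smul_mem_smul ha trivial

theorem isAdicComplete_of_sq_eq_bot {A : Type*} [CommRing A] {I : Ideal A} (hI : I ^ 2 = ⊥) :
    IsAdicComplete I A where
  haus' x hx := by
    have := hx 2
    rwa [hI, Submodule.bot_smul, SModEq.bot] at this
  prec' f hf := by
    refine ⟨f 2, fun n => ?_⟩
    rcases le_total n 2 with h | h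
    · exact hf h
    · have h1 := hf h
      rw [hI, Submodule.bot_smul, SModEq.bot] at h1
      rw [h1]

end PowerSeries

/-! ## Versality -/

section Versal

theorem exists_algHom_Cts {A : Type*} [CommRing A] [Algebra ℂ A] {ε : A →ₐ[ℂ] ℂ}
    [IsAdicComplete (RingHom.ker ε) A] {t s : A} (ht : ε t = 0) (hs : ε s = 0) :
    ∃ f : Cts →ₐ[ℂ] A, f tvar = t ∧ f svar = s ∧ ε.comp f = augTS := by
  obtain ⟨f, hf⟩ := exists_algHom_mvPowerSeries (R := ℂ) (RingHom.ker ε) ![t, s]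
    (by intro i; fin_cases i <;> simp [ht, hs])
  have h0 : f tvar = t := hf 0
  have h1 : f svar = s := hf 1
  exact ⟨f, h0, h1, aug_comp_eq_augTS (by rw [h0, ht]) (by rw [h1, hs])⟩

theorem isVersal_etaTS : IsVersal.{u} augTS lambda6 etaTS := by
  refine ⟨isCompleteLocalBase_augTS, isDeformation_family (augTS_X 0) (augTS_X 1), ?_⟩
  intro A _ _ ε hA ρ hρ
  have := hA.isLocalRing
  have := hA.isAdicComplete
  obtain ⟨t, s, ht, hs, heq⟩ := exists_equivalent_family hρ
  obtain ⟨f, hft, hfs, hf⟩ := exists_algHom_Cts ht hs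
  have hpush : pushout f etaTS = family t s := by rw [etaTS, pushout_family, hft, hfs]
  refine ⟨⟨f, hf, by rwa [hpush]⟩, fun hsq => ⟨f, ⟨hf, by rwa [hpush]⟩, ?_⟩⟩
  rintro g ⟨hg, hgeq⟩
  rw [etaTS, pushout_family] at hgeq
  have hε : ∀ i, ε (g (MvPowerSeries.X i)) = 0 := fun i => by
    rw [← AlgHom.comp_apply, hg, augTS_X]
  obtain ⟨h1, h2⟩ := eq_of_equivalent_family hsq ht (hε 1) hs (hgeq.symm.trans heq)
  exact algHom_ext_of_sq_eq_bot hsq hg hf (by rw [h1, hft]) (by rw [h2, hfs])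

theorem exists_lift_etaTrunc (k : ℕ) {B : Type*} [CommRing B] [Algebra ℂ B] (ε : B →ₐ[ℂ] ℂ)
    (hB : IsLocalRing B) (p : B →ₐ[ℂ] (Cts ⧸ RingHom.ker augTS ^ (k + 1)))
    (hp : Function.Surjective p) :
    ∃ ρ : (B ⊗[ℂ] L6) →ₗ[B] (B ⊗[ℂ] L6) →ₗ[B] (B ⊗[ℂ] L6),
      IsDeformation ε lambda6 ρ ∧ pushout p ρ = etaTrunc k := by
  have hne : RingHom.ker augTS ^ (k + 1) ≠ ⊤ := fun h =>
    RingHom.ker_ne_top augTS (top_le_iff.1 (h ▸ Ideal.pow_le_self (Nat.succ_ne_zero k)))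
  have : Nontrivial (Cts ⧸ RingHom.ker augTS ^ (k + 1)) := Ideal.Quotient.nontrivial_iff.2 hne
  -- A lift b of a variable has a nilpotent image; if ε(b) were nonzero, b would be a unit and so
  -- would this image. Hence arbitrary lifts of t and s can serve as parameters.
  have aux : ∀ {b : B} (i : Fin 2),
      p b = Ideal.Quotient.mkₐ ℂ (RingHom.ker augTS ^ (k + 1)) (MvPowerSeries.X i) →
      ε b = 0 := by
    intro b i hb
    by_contra h0
    have hu : IsUnit b := by
      have h1 : IsUnit ((ε b)⁻¹ • b) := isUnit_of_aug_eq_one ε (by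
        rw [map_smul, smul_eq_mul, inv_mul_cancel₀ h0])
      rw [Algebra.smul_def] at h1
      exact isUnit_of_mul_isUnit_right h1
    have h2 : IsUnit (p b ^ (k + 1)) := (hu.map p).pow _
    have h3 : p b ^ (k + 1) = 0 := by
      rw [hb, ← map_pow]
      exact Ideal.Quotient.eq_zero_iff_mem.2 (Ideal.pow_mem_pow (augTS_X i) _)
    rw [h3] at h2
    exact not_isUnit_zero h2
  obtain ⟨t, ht⟩ := hp (Ideal.Quotient.mkₐ ℂ (RingHom.ker augTS ^ (k + 1)) tvar)
  obtain ⟨s, hs⟩ := hp (Ideal.Quotient.mkₐ ℂ (RingHom.ker augTS ^ (k + 1)) svar)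
  refine ⟨family t s, isDeformation_family (aux 0 ht) (aux 1 hs), ?_⟩
  rw [pushout_family, etaTrunc, etaTS, pushout_family, ht, hs]

theorem etaTS_brackets :
    etaTS (1 ⊗ₜ e 0) (1 ⊗ₜ e 2) = 1 ⊗ₜ e 1 + svar ⊗ₜ e 0 ∧
      etaTS (1 ⊗ₜ e 2) (1 ⊗ₜ e 2) = 1 ⊗ₜ e 0 ∧
      etaTS (1 ⊗ₜ e 1) (1 ⊗ₜ e 2) = -(tvar ⊗ₜ e 0) ∧
      ∀ i j : Fin 3, j ≠ 2 → etaTS (1 ⊗ₜ e i) (1 ⊗ₜ e j) = 0 := by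
  simp only [etaTS, family_basis, rightMul_basis]
  refine ⟨rfl, rfl, rfl, fun i j hj => if_neg hj⟩

theorem one_parameter_deformations :
    ∃ p q : Cts →ₐ[ℂ] PowerSeries ℂ,
      p tvar = PowerSeries.X ∧ p svar = 0 ∧ q tvar = 0 ∧ q svar = PowerSeries.X ∧
      pushout p etaTS = family PowerSeries.X 0 ∧ pushout q etaTS = family 0 PowerSeries.X ∧
      IsDeformation augX lambda6 (pushout p etaTS) ∧
      IsDeformation augX lambda6 (pushout q etaTS) ∧
      ¬ Equivalent augX (pushout p etaTS) (pushout q etaTS) ∧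
      ∀ φ : PowerSeries ℂ ≃ₐ[ℂ] PowerSeries ℂ,
        ¬ Equivalent augX (pushout p etaTS)
          (pushout (φ : PowerSeries ℂ →ₐ[ℂ] PowerSeries ℂ) (pushout q etaTS)) := by
  have hX : augX PowerSeries.X = 0 := PowerSeries.constantCoeff_X
  have h0 : augX 0 = 0 := map_zero _
  obtain ⟨p, hpt, hps, -⟩ := exists_algHom_Cts (ε := augX) hX h0
  obtain ⟨q, hqt, hqs, -⟩ := exists_algHom_Cts (ε := augX) h0 hX
  have hp : pushout p etaTS = family PowerSeries.X 0 := by rw [etaTS, pushout_family, hpt, hps]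
  have hq : pushout q etaTS = family 0 PowerSeries.X := by rw [etaTS, pushout_family, hqt, hqs]
  -- Comparing traces gives 0 = u y in a domain, although y ≠ 0 and ε(u) = 1.
  have key : ∀ {y : PowerSeries ℂ}, y ≠ 0 → ¬ Equivalent augX (family PowerSeries.X 0)
      (family 0 y) := by
    intro y hy h
    obtain ⟨u, hu, h1, -⟩ := exists_scale_of_equivalent_family h
    rcases mul_eq_zero.1 h1.symm with h2 | h2
    · rw [h2, map_zero] at hu
      exact zero_ne_one hu
    · exact hy h2
  refine ⟨p, q, hpt, hps, hqt, hqs, hp, hq, ?_, ?_, ?_, fun φ => ?_⟩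
  · rw [hp]; exact isDeformation_family hX h0
  · rw [hq]; exact isDeformation_family h0 hX
  · rw [hp, hq]; exact key PowerSeries.X_ne_zero
  · rw [hp, hq, pushout_family, map_zero]
    refine key ?_
    change φ PowerSeries.X ≠ 0
    rw [Ne, EmbeddingLike.map_eq_zero_iff]
    exact PowerSeries.X_ne_zero

end Versal

/-! ## Second cohomology and the universal infinitesimal deformation -/

section Cohomology

theorem exists_L6_linear {N : Type*} [AddCommGroup N] [Module ℂ N] (v : Fin 3 → N) :
    ∃ g : L6 →ₗ[ℂ] N, ∀ i, g (e i) = v i := by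
  refine ⟨(Pi.basisFun ℂ (Fin 3)).constr ℂ v, fun i => ?_⟩
  have := (Pi.basisFun ℂ (Fin 3)).constr_basis ℂ v i
  rwa [Pi.basisFun_apply] at this

theorem lambda6_basis (i j : Fin 3) : lambda6 (e i) (e j) =
    if j = 2 then ![e 1, 0, e 0] i else 0 := by
  fin_cases i <;> fin_cases j <;> simp [lambda6, unitCochain_e]

theorem mu1_basis (i j : Fin 3) : mu1 (e i) (e j) = if j = 2 then ![0, -e 0, 0] i else 0 := by
  fin_cases i <;> fin_cases j <;> simp [mu1, unitCochain_e]

theorem mu2_basis (i j : Fin 3) : mu2 (e i) (e j) = if j = 2 then ![e 0, 0, 0] i else 0 := by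
  fin_cases i <;> fin_cases j <;> simp [mu2, unitCochain_e]

theorem L6_eq_sum (v : L6) : v = v 0 • e 0 + v 1 • e 1 + v 2 • e 2 := by
  ext i; fin_cases i <;> simp [e_apply]

/-- A cocycle vanishing on `(e₃, e₃)` and `(e₁, e₃)` is supported on `(e₂, e₃)`. -/
theorem cocycle_apply_of_normalized {f : CL2 ℂ L6} (hf : f ∈ ZL2 lambda6)
    (h22 : f (e 2) (e 2) = 0) (h02 : f (e 0) (e 2) = 0) :
    (∀ x, f x (e 0) = 0) ∧ (∀ x, f x (e 1) = 0) ∧ f (e 1) (e 2) 2 = 0 := by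
  have hz : ∀ x y z, lambda6 x (f y z) + lambda6 (f x z) y - lambda6 (f x y) z
      - f (lambda6 x y) z + f (lambda6 x z) y + f x (lambda6 y z) = 0 := fun x y z => by
    rw [← delta2_apply, LinearMap.mem_ker.1 hf]; rfl
  have l0 : ∀ x, lambda6 x (e 0) = 0 := fun x => by simp [lambda6_apply, e_apply]
  have l1 : ∀ x, lambda6 x (e 1) = 0 := fun x => by simp [lambda6_apply, e_apply]
  have h0 : ∀ x, f x (e 0) = 0 := fun x => by
    have := hz x (e 2) (e 2)
    rw [h22, show lambda6 (e 2) (e 2) = e 0 by simp [lambda6_basis]] at this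
    simpa using this
  have h1 : ∀ x, f x (e 1) = 0 := fun x => by
    have := hz x (e 0) (e 2)
    rw [h02, show lambda6 (e 0) (e 2) = e 1 by simp [lambda6_basis]] at this
    simpa [h0, l0] using this
  refine ⟨h0, h1, ?_⟩
  have := congr($(hz (e 2) (e 1) (e 2)) 0)
  rw [show lambda6 (e 1) (e 2) = 0 by simp [lambda6_basis]] at this
  simpa [h0, h1, l1, lambda6_apply, e_apply] using this

theorem exists_cocycle_decomposition {f : CL2 ℂ L6} (hf : f ∈ ZL2 lambda6) :
    ∃ (a b : ℂ) (g : L6 →ₗ[ℂ] L6), f = a • mu1 + b • mu2 + delta1 lambda6 g := by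
  have hB : ∀ g, delta1 lambda6 g ∈ ZL2 lambda6 := fun g => by
    refine LinearMap.mem_ker.2 ?_
    refine LinearMap.ext fun x => LinearMap.ext fun y => LinearMap.ext fun z => ?_
    simp only [delta2_apply, delta1_apply, map_add, map_sub, LinearMap.add_apply,
      LinearMap.sub_apply]
    rw [isLeibniz_lambda6 x y z, isLeibniz_lambda6 x (g y) z, isLeibniz_lambda6 x y (g z),
      isLeibniz_lambda6 (g x) y z, map_sub]
    simp only [LinearMap.zero_apply]
    abel
  -- Solves δg = f on (e₃,e₃) and then on (e₁,e₃), where with g(e₃) = 0 the values of δg are -g(e₁)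
  -- and [g(e₁),e₃] - g(e₂).
  obtain ⟨g, hg⟩ := exists_L6_linear
    ![-f (e 2) (e 2), lambda6 (-f (e 2) (e 2)) (e 2) - f (e 0) (e 2), 0]
  have g0 : g (e 0) = -f (e 2) (e 2) := hg 0
  have g1 : g (e 1) = lambda6 (-f (e 2) (e 2)) (e 2) - f (e 0) (e 2) := hg 1
  have g2 : g (e 2) = 0 := hg 2
  have hfz : f - delta1 lambda6 g ∈ ZL2 lambda6 := Submodule.sub_mem _ hf (hB g)
  have h22 : (f - delta1 lambda6 g) (e 2) (e 2) = 0 := by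
    rw [LinearMap.sub_apply, LinearMap.sub_apply, delta1_apply, lambda6_basis, g2]
    simp [g0]
  have h02 : (f - delta1 lambda6 g) (e 0) (e 2) = 0 := by
    rw [LinearMap.sub_apply, LinearMap.sub_apply, delta1_apply, lambda6_basis, g2]
    simp [g0, g1]
  obtain ⟨c0, c1, c2⟩ := cocycle_apply_of_normalized hfz h22 h02
  set f' := f - delta1 lambda6 g with hf'
  set w := f' (e 1) (e 2) with hw
  -- What remains is (e₂,e₃) ↦ w₀e₁ + w₁e₂ (subscripts of w counted from 0). Here δg' yields w₁e₂ at
  -- this pair and -w₁e₁ at (e₁,e₃); the latter is compensated by w₁μ₂, and w₀e₁ is -w₀μ₁.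
  obtain ⟨g', hg'⟩ := exists_L6_linear ![(0 : L6), w 1 • e 0, 0]
  have g'0 : g' (e 0) = 0 := hg' 0
  have g'1 : g' (e 1) = w 1 • e 0 := hg' 1
  have g'2 : g' (e 2) = 0 := hg' 2
  refine ⟨-w 0, w 1, g + g', ?_⟩
  have hf'' : f' = -w 0 • mu1 + w 1 • mu2 + delta1 lambda6 g' := by
    refine L6_bilin_ext fun i j => ?_
    simp only [LinearMap.add_apply, LinearMap.smul_apply, delta1_apply, mu1_basis, mu2_basis,
      lambda6_basis]
    have hj : j = 0 ∨ j = 1 ∨ j = 2 := by fin_cases j <;> simp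
    rcases hj with rfl | rfl | rfl
    · simp [c0, g'0, lambda6_apply, e_apply]
    · simp [c1, g'1, lambda6_apply, e_apply]
    · have hi : i = 0 ∨ i = 1 ∨ i = 2 := by fin_cases i <;> simp
      rcases hi with rfl | rfl | rfl
      · rw [h02]; simp [g'0, g'1, g'2]
      · rw [← hw]
        conv_lhs => rw [L6_eq_sum w, c2]
        simp [g'1, g'2, lambda6_basis]
      · rw [h22]; simp [g'0, g'2]
  rw [map_add, ← sub_add_cancel f (delta1 lambda6 g), ← hf', hf'']
  abel

/-- Comparing coordinates on the pairs (eᵢ,e₃): b is the e₃-coordinate of g(e₁) minus the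
e₁-coordinate of g(e₂), and -a is the e₃-coordinate of g(e₂). Other coordinates of the same equation
force all three to vanish. -/
theorem coeff_eq_zero_of_coboundary {a b : ℂ} {g : L6 →ₗ[ℂ] L6}
    (h : a • mu1 + b • mu2 = delta1 lambda6 g) : a = 0 ∧ b = 0 := by
  have H : ∀ i k, a * mu1 (e i) (e 2) k + b * mu2 (e i) (e 2) k =
      lambda6 (e i) (g (e 2)) k + lambda6 (g (e i)) (e 2) k - g (lambda6 (e i) (e 2)) k :=
    fun i k => congr($h (e i) (e 2) k)
  have h20 := H 2 0
  have h22 := H 2 2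
  have h00 := H 0 0
  have h10 := H 1 0
  have h11 := H 1 1
  have h02 := H 0 2
  simp only [mu1_basis, mu2_basis, lambda6_basis] at h20 h22 h00 h10 h11 h02
  simp [lambda6_apply, e_apply] at h20 h22 h00 h10 h11 h02
  have b0 : b = 0 := by rw [h00, h22, ← h11, sub_zero]
  exact ⟨by rw [h02, neg_eq_zero] at h10; exact h10, b0⟩

section HL2

variable {R : Type*} [CommRing R] {M : Type*} [AddCommGroup M] [Module R M] {b : CL2 R M}

theorem HL2.mk_surjective : Function.Surjective (HL2.mk (b := b)) :=
  Submodule.mkQ_surjective _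

theorem HL2.mk_eq_mk_iff {f g : ZL2 b} :
    HL2.mk f = HL2.mk g ↔ (f : CL2 R M) - (g : CL2 R M) ∈ BL2 b :=
  Submodule.Quotient.eq _

theorem HL2.smul_mk_add_smul_mk (c d : R) (f g : ZL2 b) :
    c • HL2.mk f + d • HL2.mk g = HL2.mk (c • f + d • g) := rfl

theorem HL2.mk_zero : HL2.mk (0 : ZL2 b) = 0 := rfl

end HL2

/-- The classes of `μ₁` and `μ₂` form a basis of the second cohomology. -/
theorem exists_basis_HL2 : ∃ h : Module.Basis (Fin 2) ℂ (HL2 lambda6),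
    h 0 = HL2.mk ⟨mu1, mu1_mem_ZL2⟩ ∧ h 1 = HL2.mk ⟨mu2, mu2_mem_ZL2⟩ := by
  let m1 : ZL2 lambda6 := ⟨mu1, mu1_mem_ZL2⟩
  let m2 : ZL2 lambda6 := ⟨mu2, mu2_mem_ZL2⟩
  have hli : LinearIndependent ℂ ![HL2.mk m1, HL2.mk m2] := by
    rw [LinearIndependent.pair_iff]
    intro a b hab
    rw [HL2.smul_mk_add_smul_mk, ← HL2.mk_zero, HL2.mk_eq_mk_iff] at hab
    obtain ⟨g, hg⟩ := hab
    refine coeff_eq_zero_of_coboundary (g := g) ?_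
    rw [hg]
    exact (sub_zero _).symm
  have hsp : ⊤ ≤ Submodule.span ℂ (Set.range ![HL2.mk m1, HL2.mk m2]) := by
    rintro x -
    obtain ⟨f, rfl⟩ := HL2.mk_surjective x
    obtain ⟨a, b, g, hfe⟩ := exists_cocycle_decomposition f.2
    have : HL2.mk f = a • HL2.mk m1 + b • HL2.mk m2 := by
      rw [HL2.smul_mk_add_smul_mk, HL2.mk_eq_mk_iff]
      refine ⟨g, ?_⟩
      change delta1 lambda6 g = f.1 - (a • mu1 + b • mu2)
      rw [hfe]; abel
    rw [this]
    exact Submodule.add_mem _ (Submodule.smul_mem _ _ (Submodule.subset_span ⟨0, rfl⟩))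
      (Submodule.smul_mem _ _ (Submodule.subset_span ⟨1, rfl⟩))
  exact ⟨Module.Basis.mk hli hsp, Module.Basis.mk_apply hli hsp 0, Module.Basis.mk_apply hli hsp 1⟩

end Cohomology

/-! ### The square-zero base and the linear truncation of ℂ[[t,s]] -/

section Infinitesimal

open TrivSqZeroExt

variable {V : Type*} [AddCommGroup V] [Module ℂ V] (h : Module.Basis (Fin 2) ℂ V)

theorem isLocalRing_trivSqZeroExt {W : Type*} [AddCommGroup W] [Module ℂ W] [Module ℂᵐᵒᵖ W]
    [IsCentralScalar ℂ W] : IsLocalRing (TrivSqZeroExt ℂ W) := by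
  refine IsLocalRing.of_isUnit_or_isUnit_one_sub_self fun x => ?_
  rw [isUnit_iff_isUnit_fst, isUnit_iff_isUnit_fst]
  exact IsLocalRing.isUnit_or_isUnit_one_sub_self _

theorem trivSqZeroExt_dual_eq (x : TrivSqZeroExt ℂ (Module.Dual ℂ V)) :
    x = algebraMap ℂ _ x.fst + x.snd (h 0) • (inr (h.coord 0) : TrivSqZeroExt ℂ (Module.Dual ℂ V)) +
      x.snd (h 1) • (inr (h.coord 1) : TrivSqZeroExt ℂ (Module.Dual ℂ V)) := by
  refine TrivSqZeroExt.ext (by simp [algebraMap_eq_inl]) ?_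
  refine h.ext fun i => ?_
  fin_cases i <;> simp [algebraMap_eq_inl]

theorem isUniversalInfinitesimal_family : IsUniversalInfinitesimal.{u}
    (fstHom ℂ ℂ (Module.Dual ℂ V)) lambda6 (family (inr (h.coord 0)) (inr (h.coord 1))) := by
  have hfin : Module.Finite ℂ V := Module.Finite.of_basis h
  refine ⟨isLocalRing_trivSqZeroExt, inferInstanceAs (Module.Finite ℂ (ℂ × Module.Dual ℂ V)),
    kerIdeal_sq ℂ _, isDeformation_family (fst_inr ℂ (h.coord 0)) (fst_inr ℂ (h.coord 1)), ?_⟩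
  intro A _ _ ε hA _ hε ρ hρ
  obtain ⟨t, s, ht, hs, heq⟩ := exists_equivalent_family hρ
  have hz : ∀ {a b : A}, ε a = 0 → ε b = 0 → a * b = 0 := fun {a b} ha hb => by
    have : a * b ∈ RingHom.ker ε ^ 2 := by
      rw [sq]; exact Ideal.mul_mem_mul ha hb
    rwa [hε] at this
  -- The linear map sending the dual basis to t, s. Its image lies in 𝔐, so products vanish and it
  -- extends to the square-zero extension.
  let g : Module.Dual ℂ V →ₗ[ℂ] A :=
    (LinearMap.applyₗ (h 0)).smulRight t + (LinearMap.applyₗ (h 1)).smulRight s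
  have hg : ∀ x, g x = x (h 0) • t + x (h 1) • s := fun _ => rfl
  have hgε : ∀ x, ε (g x) = 0 := fun x => by simp [hg, ht, hs]
  let f : TrivSqZeroExt ℂ (Module.Dual ℂ V) →ₐ[ℂ] A :=
    liftEquivOfComm ⟨g, fun x y => hz (hgε x) (hgε y)⟩
  have hfg : ∀ x, f (inr x) = g x := fun x => by simp [f]
  have h0 : f (inr (h.coord 0)) = t := by simp [hfg, hg]
  have h1 : f (inr (h.coord 1)) = s := by simp [hfg, hg]
  refine ⟨f, ⟨?_, by rwa [pushout_family, h0, h1]⟩, ?_⟩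
  · refine TrivSqZeroExt.algHom_ext fun x => ?_
    rw [AlgHom.comp_apply, hfg, hgε]
    exact (fst_inr ℂ x).symm
  · rintro f' ⟨hf', hequiv⟩
    rw [pushout_family] at hequiv
    have hε' : ∀ x, ε (f' (inr x)) = 0 := fun x => by
      rw [← AlgHom.comp_apply, hf']; exact fst_inr ℂ x
    obtain ⟨e1, e2⟩ := eq_of_equivalent_family hε ht (hε' _) hs (hequiv.symm.trans heq)
    refine AlgHom.ext fun x => ?_
    rw [trivSqZeroExt_dual_eq h x]
    simp only [map_add, map_smul, AlgHom.commutes, e1, e2, h0, h1]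

theorem exists_projection_trivSqZeroExt :
    ∃ π : Cts →ₐ[ℂ] TrivSqZeroExt ℂ (Module.Dual ℂ V),
      Function.Surjective π ∧ RingHom.ker π = RingHom.ker augTS ^ 2 ∧
      π tvar = inr (h.coord 0) ∧ π svar = inr (h.coord 1) ∧
      pushout π etaTS = family (inr (h.coord 0)) (inr (h.coord 1)) := by
  have hsq : RingHom.ker (fstHom ℂ ℂ (Module.Dual ℂ V)) ^ 2 = ⊥ := kerIdeal_sq ℂ _
  have := isAdicComplete_of_sq_eq_bot hsq
  obtain ⟨π, ht, hs, hπ⟩ := exists_algHom_Cts (ε := fstHom ℂ ℂ (Module.Dual ℂ V))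
    (t := inr (h.coord 0)) (s := inr (h.coord 1)) (fst_inr ℂ (h.coord 0)) (fst_inr ℂ (h.coord 1))
  refine ⟨π, fun x => ?_, ?_, ht, hs, by rw [etaTS, pushout_family, ht, hs]⟩
  · refine ⟨algebraMap ℂ _ x.fst + x.snd (h 0) • tvar + x.snd (h 1) • svar, ?_⟩
    conv_rhs => rw [trivSqZeroExt_dual_eq h x]
    simp only [map_add, map_smul, AlgHom.commutes, ht, hs]
  · refine le_antisymm (fun p hp => ?_) fun q hq => map_ker_augTS_sq hsq hπ hq
    obtain ⟨c, a, b, q, hq, rfl⟩ := exists_linear_part p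
    rw [RingHom.mem_ker] at hp
    simp only [map_add, map_smul, AlgHom.commutes, ht, hs, map_ker_augTS_sq hsq hπ hq] at hp
    have hc : c = 0 := by simpa [algebraMap_eq_inl] using congr(TrivSqZeroExt.fst $hp)
    have ha : a = 0 := by simpa [algebraMap_eq_inl] using congr(TrivSqZeroExt.snd $hp (h 0))
    have hb : b = 0 := by simpa [algebraMap_eq_inl] using congr(TrivSqZeroExt.snd $hp (h 1))
    simpa [hc, ha, hb] using hq

theorem perturb_eq_family {A : Type*} [CommRing A] [Algebra ℂ A] (a : Fin 2 → A) :
    perturb lambda6 a ![mu1, mu2] = family (a 0) (a 1) := by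
  refine bilin_ext fun i j => ?_
  simp [family, perturb_one_tmul, Fin.sum_univ_two]

theorem eta1_eq_family (h : Module.Basis (Fin 2) ℂ (HL2 lambda6)) :
    eta1 lambda6 h ![mu1, mu2] = family (inr (h.coord 0) : C1 lambda6) (inr (h.coord 1)) := by
  exact perturb_eq_family _

theorem isUniversalInfinitesimal_eta1 (h : Module.Basis (Fin 2) ℂ (HL2 lambda6)) :
    IsUniversalInfinitesimal.{u} (C1.aug lambda6) lambda6 (eta1 lambda6 h ![mu1, mu2]) := by
  rw [eta1_eq_family]
  exact isUniversalInfinitesimal_family h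

theorem exists_projection_C1 (h : Module.Basis (Fin 2) ℂ (HL2 lambda6)) :
    ∃ π : Cts →ₐ[ℂ] C1 lambda6,
      Function.Surjective π ∧ RingHom.ker π = RingHom.ker augTS ^ 2 ∧
      π tvar = inr (h.coord 0) ∧ π svar = inr (h.coord 1) ∧
      pushout π etaTS = eta1 lambda6 h ![mu1, mu2] := by
  rw [eta1_eq_family]
  exact exists_projection_trivSqZeroExt h

theorem exists_universal_infinitesimal :
    ∃ (h₁ : mu1 ∈ ZL2 lambda6) (h₂ : mu2 ∈ ZL2 lambda6)
        (h : Module.Basis (Fin 2) ℂ (HL2 lambda6)),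
      h 0 = HL2.mk ⟨mu1, h₁⟩ ∧ h 1 = HL2.mk ⟨mu2, h₂⟩ ∧
      IsUniversalInfinitesimal.{u} (C1.aug lambda6) lambda6 (eta1 lambda6 h ![mu1, mu2]) ∧
      ∃ π : Cts →ₐ[ℂ] C1 lambda6,
        Function.Surjective π ∧ RingHom.ker π = RingHom.ker augTS ^ 2 ∧
        π tvar = inr (h.coord 0) ∧ π svar = inr (h.coord 1) ∧
        pushout π etaTS = eta1 lambda6 h ![mu1, mu2] := by
  obtain ⟨h, h0, h1⟩ := exists_basis_HL2
  exact ⟨mu1_mem_ZL2, mu2_mem_ZL2, h, h0, h1, isUniversalInfinitesimal_eta1 h,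
    exists_projection_C1 h⟩

end Infinitesimal

/-! ## Massey brackets -/

section Obstruction

variable {A : Type*} [CommRing A] [Algebra ℂ A]

/-- The condition on τ says that A acts on it through ε, so a cochain multiplied by τ sees only the
reductions of its arguments. -/
theorem bilin_apply_eq_of_tmul {ε : A →ₐ[ℂ] ℂ} {τ : A} (hτ : ∀ a, τ * a = ε a • τ)
    (f : L6 →ₗ[ℂ] L6 →ₗ[ℂ] L6) (x y : A ⊗[ℂ] L6) :
    bilinExtend (f.compr₂ (TensorProduct.mk ℂ A L6 τ)) x y =
      τ ⊗ₜ[ℂ] f (augMap ε x) (augMap ε y) := by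
  induction x with
  | zero => simp
  | add x x' hx hx' => simp only [map_add, LinearMap.add_apply, hx, hx', TensorProduct.tmul_add]
  | tmul a l =>
    induction y with
    | zero => simp
    | add y y' hy hy' => simp only [map_add, hy, hy', TensorProduct.tmul_add]
    | tmul b l' =>
      rw [bilinExtend_tmul]
      simp only [LinearMap.compr₂_apply, TensorProduct.mk_apply, TensorProduct.smul_tmul',
        smul_eq_mul, augMap_tmul, map_smul, LinearMap.smul_apply]
      rw [mul_comm, hτ, map_mul, TensorProduct.smul_tmul, smul_smul, mul_comm]

theorem smul_eq_tmul_augMap {ε : A →ₐ[ℂ] ℂ} {τ : A} (hτ : ∀ a, τ * a = ε a • τ)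
    (v : A ⊗[ℂ] L6) : τ • v = τ ⊗ₜ[ℂ] augMap ε v := by
  induction v with
  | zero => simp
  | add x y hx hy => simp only [smul_add, map_add, hx, hy, TensorProduct.tmul_add]
  | tmul a l =>
    rw [TensorProduct.smul_tmul', smul_eq_mul, hτ, augMap_tmul, TensorProduct.smul_tmul]

theorem trilin_apply_eq_of_tmul {ε : A →ₐ[ℂ] ℂ} {τ : A} (hτ : ∀ a, τ * a = ε a • τ)
    {F : CL3 A (A ⊗[ℂ] L6)} {c : CL3 ℂ L6}
    (h : ∀ l l' l'', F (1 ⊗ₜ l) (1 ⊗ₜ l') (1 ⊗ₜ l'') = τ ⊗ₜ[ℂ] c l l' l'')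
    (x y z : A ⊗[ℂ] L6) :
    F x y z = τ ⊗ₜ[ℂ] c (augMap ε x) (augMap ε y) (augMap ε z) := by
  have t1 : ∀ (a : A) (l : L6), a ⊗ₜ[ℂ] l = a • ((1 : A) ⊗ₜ[ℂ] l) := fun a l => by
    simp [TensorProduct.smul_tmul']
  induction x with
  | zero => simp
  | add x x' hx hx' => simp only [map_add, LinearMap.add_apply, hx, hx', TensorProduct.tmul_add]
  | tmul a l =>
    induction y with
    | zero => simp
    | add y y' hy hy' => simp only [map_add, LinearMap.add_apply, hy, hy', TensorProduct.tmul_add]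
    | tmul b l' =>
      induction z with
      | zero => simp
      | add y y' hy hy' => simp only [map_add, hy, hy', TensorProduct.tmul_add]
      | tmul d l'' =>
        rw [t1 a, t1 b, t1 d]
        simp only [map_smul, LinearMap.smul_apply, h, augMap_smul, augMap_tmul, map_one, one_smul]
        simp only [TensorProduct.smul_tmul', smul_eq_mul]
        rw [← TensorProduct.smul_tmul, ← TensorProduct.smul_tmul, ← TensorProduct.smul_tmul]
        congr 1
        have k : ∀ a, a * τ = ε a • τ := fun a => by rw [mul_comm, hτ]
        simp only [k, mul_smul_comm, smul_smul]
        congr 1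
        ring

theorem tmul_left_injective {τ : A} (hτ : τ ≠ 0) {v w : L6} (h : τ ⊗ₜ[ℂ] v = τ ⊗ₜ[ℂ] w) :
    v = w := by
  ext i
  have := congr((stdBasis A).repr $h i)
  rw [stdBasis_repr_tmul, stdBasis_repr_tmul] at this
  exact smul_left_injective ℂ hτ this

/-- If `ρ` reduces to the bracket of `λ₆` and satisfies the Leibniz identity up to a socle element
`τ`, then the obstruction cochain, which is the coefficient of `τ`, is a coboundary. -/
theorem obstruction_mem_BL3 [IsLocalRing A] {ε : A →ₐ[ℂ] ℂ} {τ : A}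
    (hτ : ∀ a, τ * a = ε a • τ) (hετ : ε τ = 0) (hτ0 : τ ≠ 0)
    {ρ : (A ⊗[ℂ] L6) →ₗ[A] (A ⊗[ℂ] L6) →ₗ[A] (A ⊗[ℂ] L6)}
    (haug : ∀ x y, augMap ε (ρ x y) = lambda6 (augMap ε x) (augMap ε y)) {c : CL3 ℂ L6}
    (hc : ∀ l l' l'', circ ρ ρ (1 ⊗ₜ l) (1 ⊗ₜ l') (1 ⊗ₜ l'') = τ ⊗ₜ[ℂ] c l l' l'') :
    c ∈ BL3 lambda6 := by
  have hN : ∀ v ∈ Ideal.span {τ} • (⊤ : Submodule A (A ⊗[ℂ] L6)), ∃ w : L6, v = τ ⊗ₜ[ℂ] w := by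
    intro v hv
    rw [Submodule.ideal_span_singleton_smul, Submodule.mem_smul_pointwise_iff_exists] at hv
    obtain ⟨w, -, rfl⟩ := hv
    exact ⟨_, smul_eq_tmul_augMap hτ w⟩
  obtain ⟨t, s, φ, ht, hs, hφ, H⟩ := exists_normal_form_mod (Ideal.span {τ}) haug (fun x y z => by
    rw [trilin_apply_eq_of_tmul hτ hc, show ∀ w : L6, τ ⊗ₜ[ℂ] w = τ • ((1 : A) ⊗ₜ[ℂ] w) from
      fun w => by simp [TensorProduct.smul_tmul']]
    exact Submodule.smul_mem_smul (Ideal.mem_span_singleton_self τ) trivial)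
  have hd := isDeformation_family ht hs
  -- The normal form transported back along φ: an exact Leibniz bracket that agrees with ρ modulo τ.
  obtain ⟨σ, hσ⟩ : ∃ σ : (A ⊗[ℂ] L6) →ₗ[A] (A ⊗[ℂ] L6) →ₗ[A] (A ⊗[ℂ] L6),
      ∀ x y, σ x y = φ (family t s (φ.symm x) (φ.symm y)) :=
    ⟨((family t s).compl₁₂ φ.symm.toLinearMap φ.symm.toLinearMap).compr₂ φ.toLinearMap,
      fun _ _ => rfl⟩
  have hσL : IsLeibniz σ := fun x y z => by simp [hσ, hd.isLeibniz (φ.symm x)]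
  have hσε : ∀ x y, augMap ε (σ x y) = lambda6 (augMap ε x) (augMap ε y) := fun x y => by
    rw [hσ, hφ, hd.augMap_hom, ← hφ, ← hφ (φ.symm y)]; simp
  have hD : ∀ i j, ∃ w : L6,
      ρ (1 ⊗ₜ e i) (1 ⊗ₜ e j) - σ (1 ⊗ₜ e i) (1 ⊗ₜ e j) = τ ⊗ₜ[ℂ] w := fun i j => by
    have := H (φ.symm (1 ⊗ₜ e i)) (φ.symm (1 ⊗ₜ e j))
    rw [LinearEquiv.apply_symm_apply, LinearEquiv.apply_symm_apply, ← hσ] at this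
    exact hN _ this
  choose w hw using hD
  choose r hr using fun i => exists_L6_linear (w i)
  obtain ⟨f, hf⟩ := exists_L6_linear r
  have hρσ : ∀ x y, ρ x y = σ x y + τ ⊗ₜ[ℂ] f (augMap ε x) (augMap ε y) := by
    intro x y
    rw [← bilin_apply_eq_of_tmul hτ, ← LinearMap.add_apply, ← LinearMap.add_apply]
    congr 2
    refine bilin_ext fun i j => ?_
    rw [LinearMap.add_apply, LinearMap.add_apply, bilin_apply_eq_of_tmul hτ, ← sub_eq_iff_eq_add',
      hw]
    simp [hf, hr]
  have hl : ∀ l y, σ (τ ⊗ₜ[ℂ] l) y = τ ⊗ₜ[ℂ] lambda6 l (augMap ε y) := fun l y => by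
    rw [show τ ⊗ₜ[ℂ] l = τ • ((1 : A) ⊗ₜ[ℂ] l) by simp [TensorProduct.smul_tmul'], map_smul,
      LinearMap.smul_apply, smul_eq_tmul_augMap hτ, hσε]
    simp
  have hrt : ∀ x l, σ x (τ ⊗ₜ[ℂ] l) = τ ⊗ₜ[ℂ] lambda6 (augMap ε x) l := fun x l => by
    rw [show τ ⊗ₜ[ℂ] l = τ • ((1 : A) ⊗ₜ[ℂ] l) by simp [TensorProduct.smul_tmul'], map_smul,
      smul_eq_tmul_augMap hτ, hσε]
    simp
  -- Since ε(τ) = 0, terms quadratic in f vanish. The defect of ρ = σ + τ ⊗ f is therefore τ times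
  -- the cross terms [λ₆,f] = -δf, whence c = δ(-f).
  refine ⟨-f, ?_⟩
  refine LinearMap.ext fun x => LinearMap.ext fun y => LinearMap.ext fun z => ?_
  refine tmul_left_injective hτ0 ?_
  rw [← hc, circ_apply]
  simp only [hρσ, map_add, LinearMap.add_apply, hl, hrt, hσε, augMap_tmul, hετ, zero_smul,
    add_zero, map_zero, LinearMap.zero_apply, map_one, one_smul, map_neg, LinearMap.neg_apply, delta2_apply,
    TensorProduct.tmul_add, TensorProduct.tmul_sub, TensorProduct.tmul_neg, TensorProduct.tmul_zero]
  rw [hσL]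
  abel

end Obstruction

section SquarefreeAlgebra

/-- The algebra `ℂ[ε₁, …, εₙ] / (εᵢ²)`, with its squarefree monomials. -/
theorem exists_squarefree_algebra (n : ℕ) :
    ∃ (A : Type) (_ : CommRing A) (_ : Algebra ℂ A) (ε : A →ₐ[ℂ] ℂ) (X : Finset (Fin n) → A),
      IsLocalRing A ∧ X ∅ = 1 ∧ (∀ J K, X J * X K = if Disjoint J K then X (J ∪ K) else 0) ∧
      X Finset.univ ≠ 0 ∧ (∀ I, I.Nonempty → ε (X I) = 0) ∧
      ∀ a, X Finset.univ * a = ε a • X Finset.univ := by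
  -- Power series rather than polynomials: the quotient inherits locality.
  let P := MvPowerSeries (Fin n) ℂ
  let V : Fin n → P := MvPowerSeries.X
  let K : Ideal P := Ideal.span (Set.range fun i => V i ^ 2)
  let ε₀ : P →ₐ[ℂ] ℂ :=
    { toRingHom := MvPowerSeries.constantCoeff
      commutes' := fun c => MvPowerSeries.constantCoeff_C c }
  have hV : ∀ i, ε₀ (V i) = 0 := fun i => MvPowerSeries.constantCoeff_X i
  have hK : ∀ a ∈ K, ε₀ a = 0 := by
    have : K ≤ RingHom.ker ε₀ := by
      rw [Ideal.span_le]
      rintro _ ⟨i, rfl⟩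
      simp [hV, RingHom.mem_ker]
    exact fun a ha => this ha
  let ε : (P ⧸ K) →ₐ[ℂ] ℂ := Ideal.Quotient.liftₐ K ε₀ hK
  let q : P →ₐ[ℂ] (P ⧸ K) := Ideal.Quotient.mkₐ ℂ K
  have hq : ∀ a, q a = 0 ↔ a ∈ K := fun a => Ideal.Quotient.eq_zero_iff_mem
  have hsq : ∀ i, q (V i) * q (V i) = 0 := fun i => by
    rw [← map_mul, hq, ← sq]; exact Ideal.subset_span ⟨i, rfl⟩
  have hmon : ∀ S : Finset (Fin n), ∏ i ∈ S, V i =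
      MvPowerSeries.monomial (∑ i ∈ S, Finsupp.single i 1) 1 := by
    intro S
    induction S using Finset.induction_on with
    | empty => simp
    | insert a S ha ih =>
      rw [Finset.prod_insert ha, Finset.sum_insert ha, ih]
      change MvPowerSeries.monomial _ _ * _ = _
      rw [MvPowerSeries.monomial_mul_monomial, one_mul]
  have hmul : ∀ J K : Finset (Fin n), (∏ i ∈ J, q (V i)) * ∏ i ∈ K, q (V i) =
      if Disjoint J K then ∏ i ∈ J ∪ K, q (V i) else 0 := by
    intro J K
    split_ifs with h
    · rw [Finset.prod_union h]
    · obtain ⟨i, hi, hi'⟩ := Finset.not_disjoint_iff.1 h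
      rw [← Finset.mul_prod_erase J _ hi, ← Finset.mul_prod_erase K _ hi']
      linear_combination (∏ x ∈ J.erase i, q (V x)) * (∏ x ∈ K.erase i, q (V x)) * hsq i
  have hne : ∏ i, q (V i) ≠ 0 := by
    rw [← map_prod, Ne, hq, hmon]
    intro h
    rw [Ideal.mem_span_range_iff_exists_fun] at h
    obtain ⟨c, hc⟩ := h
    -- At the exponent (1,…,1) the full product has coefficient 1, while a multiple of a squared
    -- variable has coefficient 0.
    have h1 := congr(MvPowerSeries.coeff (∑ i, Finsupp.single i 1) $hc)
    rw [MvPowerSeries.coeff_monomial_same, map_sum, Finset.sum_eq_zero] at h1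
    · exact zero_ne_one h1
    · intro i _
      change MvPowerSeries.coeff _ (c i * MvPowerSeries.X i ^ 2) = 0
      rw [MvPowerSeries.X_pow_eq, MvPowerSeries.coeff_mul_monomial, if_neg]
      intro hle
      have h2 := hle i
      rw [Finsupp.finsetSum_apply] at h2
      simp [Finsupp.single_apply] at h2
  have hnt : Nontrivial (P ⧸ K) := ⟨⟨_, _, hne⟩⟩
  refine ⟨P ⧸ K, inferInstance, inferInstance, ε, fun I => ∏ i ∈ I, q (V i),
    IsLocalRing.of_surjective' (Ideal.Quotient.mk K) Ideal.Quotient.mk_surjective, by simp, hmul,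
    hne, ?_, ?_⟩
  · rintro I ⟨i, hi⟩
    rw [map_prod]
    exact Finset.prod_eq_zero hi (hV i)
  · intro a
    obtain ⟨p, rfl⟩ := Ideal.Quotient.mk_surjective a
    change (∏ i, q (V i)) * q p = ε₀ p • ∏ i, q (V i)
    have h0 : p - algebraMap ℂ P (ε₀ p) ∈ Ideal.span (Set.range V) := by
      refine mem_span_X_of_constantCoeff_eq_zero ?_
      change ε₀ _ = 0
      rw [map_sub, AlgHom.commutes]; exact sub_self _
    rw [Ideal.mem_span_range_iff_exists_fun] at h0
    obtain ⟨c, hc⟩ := h0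
    have hsm : ∀ (r : ℂ) (b : P ⧸ K), r • b = q (algebraMap ℂ P r) * b := fun r b => by
      rw [AlgHom.commutes]; exact Algebra.smul_def r b
    rw [← sub_eq_zero, hsm, mul_comm _ (q p), ← sub_mul, ← map_sub, ← hc, map_sum, Finset.sum_mul]
    refine Finset.sum_eq_zero fun i _ => ?_
    have := hmul {i} Finset.univ
    rw [if_neg (by simp), Finset.prod_singleton] at this
    rw [map_mul, mul_assoc, this, mul_zero]

end SquarefreeAlgebra

/-! ### Defining systems as brackets over the squarefree algebra -/

section Massey

theorem CL3_neg_zero : -(0 : CL3 ℂ L6) = 0 := by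
  refine LinearMap.ext fun x => ?_
  simp

theorem CL3_neg_neg_add (f : CL3 ℂ L6) : - -f + -f = 0 := by
  refine LinearMap.ext fun x => ?_
  simp

/-- Passing from J to I \ J interchanges the two halves of the symmetric bracket, which cancels the
factor 1/2. -/
theorem masseySum_eq_sum_circ {L : Type*} [AddCommGroup L] [Module ℂ L] {n : ℕ}
    (m : Finset (Fin n) → CL2 ℂ L) (I : Finset (Fin n)) : masseySum m I =
      ∑ J ∈ I.powerset.filter (fun J => J.Nonempty ∧ J ≠ I), circ (m (I \ J)) (m J) := by
  have hsw : ∑ J ∈ I.powerset.filter (fun J => J.Nonempty ∧ J ≠ I), circ (m J) (m (I \ J)) =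
      ∑ J ∈ I.powerset.filter (fun J => J.Nonempty ∧ J ≠ I), circ (m (I \ J)) (m J) := by
    have hmem : ∀ J ∈ I.powerset.filter (fun J => J.Nonempty ∧ J ≠ I),
        I \ J ∈ I.powerset.filter (fun J => J.Nonempty ∧ J ≠ I) ∧ I \ (I \ J) = J := by
      intro J hJ
      rw [Finset.mem_filter, Finset.mem_powerset] at hJ
      obtain ⟨h1, h2, h3⟩ := hJ
      refine ⟨?_, by rw [Finset.sdiff_sdiff_eq_self h1]⟩
      rw [Finset.mem_filter, Finset.mem_powerset]
      refine ⟨Finset.sdiff_subset, ?_, fun h => ?_⟩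
      · rw [Finset.sdiff_nonempty]
        exact fun h => h3 (Finset.Subset.antisymm h1 h)
      · obtain ⟨x, hx⟩ := h2
        have := h ▸ h1 hx
        rw [Finset.mem_sdiff] at this
        exact this.2 hx
    refine Finset.sum_nbij' (fun J => I \ J) (fun J => I \ J) (fun J hJ => (hmem J hJ).1)
      (fun J hJ => (hmem J hJ).1) (fun J hJ => (hmem J hJ).2) (fun J hJ => (hmem J hJ).2)
      (fun J hJ => by rw [(hmem J hJ).2])
  rw [masseySum]
  simp only [superBracket]
  rw [Finset.sum_add_distrib, hsw, ← two_smul ℂ, smul_smul, inv_mul_cancel₀ two_ne_zero, one_smul]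

theorem superBracket_eq_zero_of_mem_span {α β : CL2 ℂ L6}
    (hα : α ∈ Submodule.span ℂ {mu1, mu2}) (hβ : β ∈ Submodule.span ℂ {mu1, mu2}) :
    superBracket α β = 0 := by
  obtain ⟨a, b, rfl⟩ := Submodule.mem_span_pair.1 hα
  obtain ⟨c, d, rfl⟩ := Submodule.mem_span_pair.1 hβ
  refine LinearMap.ext fun x => LinearMap.ext fun y => LinearMap.ext fun z => ?_
  simp only [superBracket, LinearMap.add_apply, circ_apply, LinearMap.smul_apply]
  ext i; fin_cases i <;> simp [mu1_apply, mu2_apply]; ring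

theorem exists_trivial_definingSystem {n : ℕ} (x : Fin n → CL2 ℂ L6)
    (hx : ∀ i, x i ∈ Submodule.span ℂ {mu1, mu2}) :
    ∃ m : Finset (Fin n) → CL2 ℂ L6, IsDefiningSystem lambda6 x m ∧
      (∀ I : Finset (Fin n), 2 ≤ I.card → m I = 0) ∧ masseySum m Finset.univ = 0 := by
  -- The sum covers both small cases: it is xᵢ on a singleton and 0 on the empty set.
  let m : Finset (Fin n) → CL2 ℂ L6 := fun I => if 2 ≤ I.card then 0 else ∑ i ∈ I, x i
  have hm : ∀ I, m I = if 2 ≤ I.card then 0 else ∑ i ∈ I, x i := fun _ => rfl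
  have hspan : ∀ I, m I ∈ Submodule.span ℂ {mu1, mu2} := fun I => by
    rw [hm]
    split_ifs
    · exact Submodule.zero_mem _
    · exact Submodule.sum_mem _ fun i _ => hx i
  have hsum : ∀ I, masseySum m I = 0 := fun I => by
    rw [masseySum, Finset.sum_eq_zero fun J _ =>
      superBracket_eq_zero_of_mem_span (hspan J) (hspan (I \ J)), smul_zero]
  have h2 : ∀ I : Finset (Fin n), 2 ≤ I.card → m I = 0 := fun I hI => by rw [hm, if_pos hI]
  refine ⟨m, ⟨fun i => by simp [hm], fun I hI _ => ?_⟩, h2, hsum _⟩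
  rw [h2 I hI, map_zero, CL3_neg_zero, hsum]

/-- Splitting off the two trivial partitions from a sum over all ordered partitions. -/
theorem sum_powerset_circ {n : ℕ} (M : Finset (Fin n) → CL2 ℂ L6) {I : Finset (Fin n)}
    (hI : I.Nonempty) : ∑ J ∈ I.powerset, circ (M (I \ J)) (M J) =
      superBracket (M ∅) (M I) +
        ∑ J ∈ I.powerset.filter (fun J => J.Nonempty ∧ J ≠ I), circ (M (I \ J)) (M J) := by
  have hsplit : I.powerset = insert ∅ (insert I
      (I.powerset.filter (fun J => J.Nonempty ∧ J ≠ I))) := by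
    ext J
    simp only [Finset.mem_insert, Finset.mem_filter, Finset.mem_powerset,
      Finset.nonempty_iff_ne_empty]
    constructor
    · intro h
      by_cases h1 : J = ∅ <;> by_cases h2 : J = I <;> simp [h1, h2, h]
    · rintro (rfl | rfl | h)
      · exact Finset.empty_subset _
      · exact Finset.Subset.refl _
      · exact h.1
  conv_lhs => rw [hsplit]
  rw [Finset.sum_insert, Finset.sum_insert, Finset.sdiff_self, Finset.sdiff_empty, superBracket,
    ← add_assoc, add_comm (circ (M I) (M ∅))]
  · simp
  · simp [hI.ne_empty.symm]

/-- Only disjoint pairs (J, K) contribute to the product expansion, and they correspond to pairs J ⊆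
I through I = J ∪ K. -/
theorem circ_total {n : ℕ} {A : Type*} [CommRing A] [Algebra ℂ A] (X : Finset (Fin n) → A)
    (hX : ∀ J K, X J * X K = if Disjoint J K then X (J ∪ K) else 0)
    (M : Finset (Fin n) → CL2 ℂ L6)
    {ρ : (A ⊗[ℂ] L6) →ₗ[A] (A ⊗[ℂ] L6) →ₗ[A] (A ⊗[ℂ] L6)}
    (hρ : ∀ a a' l l', ρ (a ⊗ₜ l) (a' ⊗ₜ l') = ∑ I, (a * a' * X I) ⊗ₜ[ℂ] M I l l')
    (x y z : L6) : circ ρ ρ (1 ⊗ₜ x) (1 ⊗ₜ y) (1 ⊗ₜ z) =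
      ∑ I, X I ⊗ₜ[ℂ] (∑ J ∈ I.powerset, circ (M (I \ J)) (M J)) x y z := by
  have h1 : circ ρ ρ (1 ⊗ₜ x) (1 ⊗ₜ y) (1 ⊗ₜ z) =
      ∑ J, ∑ K, (X J * X K) ⊗ₜ[ℂ] circ (M K) (M J) x y z := by
    simp only [circ_apply, hρ, map_sum, LinearMap.sum_apply, one_mul, mul_one,
      TensorProduct.tmul_sub, Finset.sum_sub_distrib]
  rw [h1, ← Finset.sum_product', Finset.univ_product_univ]
  simp only [LinearMap.sum_apply, TensorProduct.tmul_sum]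
  rw [Finset.sum_sigma', ← Finset.sum_filter_of_ne (p := fun q : Finset (Fin n) × Finset (Fin n) =>
    Disjoint q.1 q.2)]
  · refine Finset.sum_bij' (fun q _ => ⟨q.1 ∪ q.2, q.1⟩) (fun s _ => (s.2, s.1 \ s.2)) ?_ ?_ ?_ ?_ ?_
    · intro q _
      exact Finset.mem_sigma.2 ⟨Finset.mem_univ _, Finset.mem_powerset.2 Finset.subset_union_left⟩
    · intro s _; simpa using Finset.disjoint_sdiff
    · rintro ⟨J, K⟩ h
      have h : Disjoint J K := by simpa using h
      simp [Finset.union_sdiff_cancel_left h]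
    · rintro ⟨I, J⟩ h
      have h : J ⊆ I := by simpa using h
      simp [Finset.union_sdiff_of_subset h]
    · rintro ⟨J, K⟩ h
      have h : Disjoint J K := by simpa using h
      simp [hX, h, Finset.union_sdiff_cancel_left h]
  · intro q _ hq
    by_contra h
    rw [hX, if_neg h] at hq
    simp at hq

theorem massey_mem_BL3 {n : ℕ} (hn : 2 ≤ n) {x : Fin n → CL2 ℂ L6}
    (hx : ∀ i, x i ∈ ZL2 lambda6) {c : CL3 ℂ L6} (hc : RepresentsMassey lambda6 x c) :
    c ∈ BL3 lambda6 := by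
  obtain ⟨m, ⟨hm1, hm2⟩, rfl⟩ := hc
  obtain ⟨A, _, _, ε, X, hA, hX0, hX, hXne, hXε, hXτ⟩ := exists_squarefree_algebra n
  have hne : (Finset.univ : Finset (Fin n)).Nonempty := ⟨⟨0, by omega⟩, Finset.mem_univ _⟩
  -- The sign cancels in quadratic terms but not in the term linear in `m I`, so the defining
  -- equations -δ(m I) = `masseySum m I` become the vanishing of the X_I-coefficient of the defect.
  -- The top value is set to 0, so that the top coefficient is exactly the Massey cochain.
  let M : Finset (Fin n) → CL2 ℂ L6 := fun I =>
    if I = ∅ then lambda6 else if I = Finset.univ then 0 else -m I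
  have hM0 : M ∅ = lambda6 := if_pos rfl
  have hMu : M Finset.univ = 0 := by
    change (if _ then _ else _) = _
    rw [if_neg hne.ne_empty, if_pos rfl]
  have hM : ∀ I, I.Nonempty → I ≠ Finset.univ → M I = -m I := fun I h1 h2 => by
    change (if _ then _ else _) = _
    rw [if_neg h1.ne_empty, if_neg h2]
  have hcoef : ∀ I, I.Nonempty → ∑ J ∈ I.powerset, circ (M (I \ J)) (M J) =
      -delta2 lambda6 (M I) + masseySum m I := by
    intro I hI
    rw [sum_powerset_circ M hI, hM0, superBracket_eq_neg_delta2, masseySum_eq_sum_circ]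
    congr 1
    refine Finset.sum_congr rfl fun J hJ => ?_
    rw [Finset.mem_filter, Finset.mem_powerset] at hJ
    obtain ⟨h1, h2, h3⟩ := hJ
    have h4 : (I \ J).Nonempty := by
      rw [Finset.sdiff_nonempty]
      exact fun h => h3 (Finset.Subset.antisymm h1 h)
    have h5 : J ≠ Finset.univ := by
      rintro rfl
      exact h3 (Finset.Subset.antisymm h1 (Finset.subset_univ _))
    have h6 : I \ J ≠ Finset.univ := by
      intro h
      obtain ⟨y, hy⟩ := h2
      have := h ▸ Finset.mem_univ y
      rw [Finset.mem_sdiff] at this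
      exact this.2 hy
    rw [hM J h2 h5, hM _ h4 h6]
    refine LinearMap.ext fun x => LinearMap.ext fun y => LinearMap.ext fun z => ?_
    simp [circ_apply]
  have hzero : ∀ I, I ≠ Finset.univ → ∑ J ∈ I.powerset, circ (M (I \ J)) (M J) = 0 := by
    intro I hI
    rcases I.eq_empty_or_nonempty with rfl | hI'
    · simpa [hM0] using (isLeibniz_iff_circ lambda6).1 isLeibniz_lambda6
    · rw [hcoef I hI', hM I hI' hI, map_neg]
      by_cases h2 : 2 ≤ I.card
      · rw [← hm2 I h2 hI, CL3_neg_neg_add]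
      · obtain ⟨i, rfl⟩ : ∃ i, I = {i} := by
          rw [← Finset.card_eq_one]
          have := hI'.card_pos
          omega
        have h3 : ({i} : Finset (Fin n)).powerset.filter (fun J => J.Nonempty ∧ J ≠ {i}) = ∅ := by
          rw [Finset.filter_eq_empty_iff]
          intro J hJ h
          rcases Finset.subset_singleton_iff.1 (Finset.mem_powerset.1 hJ) with rfl | rfl
          · exact Finset.not_nonempty_empty h.1
          · exact h.2 rfl
        rw [masseySum, h3, Finset.sum_empty, smul_zero, hm1, LinearMap.mem_ker.1 (hx i), CL3_neg_zero,
          CL3_neg_zero, add_zero]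
  let ρ : (A ⊗[ℂ] L6) →ₗ[A] (A ⊗[ℂ] L6) →ₗ[A] (A ⊗[ℂ] L6) :=
    bilinExtend (∑ I, (M I).compr₂ (TensorProduct.mk ℂ A L6 (X I)))
  have hρ : ∀ a a' l l', ρ (a ⊗ₜ l) (a' ⊗ₜ l') = ∑ I, (a * a' * X I) ⊗ₜ[ℂ] M I l l' := by
    intro a a' l l'
    rw [bilinExtend_tmul]
    simp [LinearMap.sum_apply, Finset.smul_sum, TensorProduct.smul_tmul']
  have haug : ∀ x y, augMap ε (ρ x y) = lambda6 (augMap ε x) (augMap ε y) := by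
    refine augMap_hom_of_basis fun i j => ?_
    rw [hρ, map_sum, Finset.sum_eq_single ∅]
    · simp [hX0, hM0]
    · intro I _ hI
      rw [augMap_tmul, one_mul, one_mul, hXε I (Finset.nonempty_iff_ne_empty.2 hI), zero_smul]
    · simp
  refine obstruction_mem_BL3 hXτ (hXε _ hne) hXne haug fun l l' l'' => ?_
  rw [circ_total X hX M hρ, Finset.sum_eq_single Finset.univ]
  · rw [hcoef _ hne, hMu, map_zero, CL3_neg_zero, zero_add]
  · intro I _ hI
    rw [hzero I hI]; simp
  · simp

end Massey

end

end LeibnizDef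

open LeibnizDef in
theorem mainTheorem5 :
    -- `λ₆` is a Leibniz algebra
    IsLeibniz lambda6 ∧
    -- Massey brackets of the chosen representatives: the superbrackets vanish as cochains, and all
    -- higher brackets are represented by the zero cochain, for the zero choices at each stage
    (superBracket mu1 mu1 = 0 ∧ superBracket mu1 mu2 = 0 ∧ superBracket mu2 mu2 = 0) ∧
    (∀ (n : ℕ), 2 ≤ n → ∀ x : Fin n → CL2 ℂ L6,
      (∀ i, x i ∈ Submodule.span ℂ {mu1, mu2}) →
      ∃ m : Finset (Fin n) → CL2 ℂ L6, IsDefiningSystem lambda6 x m ∧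
        (∀ I : Finset (Fin n), 2 ≤ I.card → m I = 0) ∧
        masseySum m Finset.univ = 0) ∧
    -- every Massey bracket of classes in `HL²`, for every defining system, is zero in `HL³`
    (∀ (n : ℕ), 2 ≤ n → ∀ x : Fin n → CL2 ℂ L6, (∀ i, x i ∈ ZL2 lambda6) →
      ∀ c : CL3 ℂ L6, RepresentsMassey lambda6 x c → c ∈ BL3 lambda6) ∧
    -- no obstructions: at every stage the deformation extends to every extension of the base
    (∀ (k : ℕ) (B : Type u) [CommRing B] [Algebra ℂ B] (ε : B →ₐ[ℂ] ℂ),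
      IsLocalRing B → Module.Finite ℂ B →
      ∀ p : B →ₐ[ℂ] (Cts ⧸ RingHom.ker augTS ^ (k + 1)), Function.Surjective p →
        ∃ ρ : (B ⊗[ℂ] L6) →ₗ[B] (B ⊗[ℂ] L6) →ₗ[B] (B ⊗[ℂ] L6),
          IsDeformation ε lambda6 ρ ∧ pushout p ρ = etaTrunc k) ∧
    -- `μ₁`, `μ₂` represent a basis of `HL²`; the associated `η₁` is the universal infinitesimal
    -- deformation, and it is the reduction of the deformation with base `ℂ[[t, s]]`
    (∃ (h₁ : mu1 ∈ ZL2 lambda6) (h₂ : mu2 ∈ ZL2 lambda6)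
        (h : Module.Basis (Fin 2) ℂ (HL2 lambda6)),
      h 0 = HL2.mk ⟨mu1, h₁⟩ ∧ h 1 = HL2.mk ⟨mu2, h₂⟩ ∧
      IsUniversalInfinitesimal.{u} (C1.aug lambda6) lambda6 (eta1 lambda6 h ![mu1, mu2]) ∧
      ∃ π : Cts →ₐ[ℂ] C1 lambda6,
        Function.Surjective π ∧ RingHom.ker π = RingHom.ker augTS ^ 2 ∧
        π tvar = TrivSqZeroExt.inr (h.coord 0) ∧ π svar = TrivSqZeroExt.inr (h.coord 1) ∧
        pushout π etaTS = eta1 lambda6 h ![mu1, mu2]) ∧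
    -- versality
    IsVersal.{u} augTS lambda6 etaTS ∧
    -- the brackets of the versal deformation
    (etaTS (1 ⊗ₜ e 0) (1 ⊗ₜ e 2) = 1 ⊗ₜ e 1 + svar ⊗ₜ e 0 ∧
      etaTS (1 ⊗ₜ e 2) (1 ⊗ₜ e 2) = 1 ⊗ₜ e 0 ∧
      etaTS (1 ⊗ₜ e 1) (1 ⊗ₜ e 2) = -(tvar ⊗ₜ e 0) ∧
      ∀ i j : Fin 3, j ≠ 2 → etaTS (1 ⊗ₜ e i) (1 ⊗ₜ e j) = 0) ∧
    -- the two 1-parameter deformations, obtained by `s = 0` and by `t = 0`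
    (∃ p q : Cts →ₐ[ℂ] PowerSeries ℂ,
      p tvar = PowerSeries.X ∧ p svar = 0 ∧ q tvar = 0 ∧ q svar = PowerSeries.X ∧
      pushout p etaTS = family PowerSeries.X 0 ∧ pushout q etaTS = family 0 PowerSeries.X ∧
      IsDeformation augX lambda6 (pushout p etaTS) ∧
      IsDeformation augX lambda6 (pushout q etaTS) ∧
      ¬ Equivalent augX (pushout p etaTS) (pushout q etaTS) ∧
      ∀ φ : PowerSeries ℂ ≃ₐ[ℂ] PowerSeries ℂ,
        ¬ Equivalent augX (pushout p etaTS)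
          (pushout (φ : PowerSeries ℂ →ₐ[ℂ] PowerSeries ℂ) (pushout q etaTS))) := by
  exact ⟨isLeibniz_lambda6, ⟨superBracket_mu1_mu1, superBracket_mu1_mu2, superBracket_mu2_mu2⟩,
    fun _ _ x hx => exists_trivial_definingSystem x hx,
    fun _ hn _ hx _ hc => massey_mem_BL3 hn hx hc,
    fun k _ _ _ ε hB _ p hp => exists_lift_etaTrunc k ε hB p hp,
    exists_universal_infinitesimal, isVersal_etaTS, etaTS_brackets, one_parameter_deformations⟩
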